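/- **Definitions.** Let $\Theta$ be a finite set of atomic propositions. The classical language $\mathcal L_C$ is generated by $\Theta,\bot,\top$ under $\neg,\to,\wedge,\vee$. The language $\mathcal L\supset\mathcal L_C$ is generated by $\Theta,\bot,\top$ under $\neg,\to,\wedge,\vee$, the modalities $\Box,\Diamond$, the conditional $(\psi|\phi)$ and the logical independence $\psi\times\phi$. Write $\phi\leftrightarrow\psi$ for $(\phi\to\psi)\wedge(\psi\to\phi)$, and $\phi\equiv\psi$ for $\vdash\phi\leftrightarrow\psi$; an axiom written $\phi\equiv\psi$ means that both $\phi\to\psi$ and $\psi\to\phi$ are axioms. Classical logic $C$ (provability $\vdash_C$, equivalence $\equiv_C$) on $\mathcal L_C$ has modus ponens and the axiom schemes c1–c7: $\top$; $\phi\to(\psi\to\phi)$; $(\eta\to(\phi\to\psi))\to((\eta\to\phi)\to(\eta\to\psi))$; $(\neg\phi\to\neg\psi)\to((\neg\phi\to\psi)\to\phi)$; $\bot\equiv\neg\top$; $(\phi\to\psi)\equiv(\neg\phi\vee\psi)$; $(\phi\wedge\psi)\equiv\neg(\neg\phi\vee\neg\psi)$. The logic DmBL on $\mathcal L$ has modus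 ponens, the rule "$\vdash\phi$ implies $\vdash\Box\phi$", the schemes c1–c7 for all formulas of $\mathcal L$, and * m2–m4: $\Box(\phi\to\psi)\to(\Box\phi\to\Box\psi)$; $\ \Box\phi\to\phi$; $\ \Diamond\phi\equiv\neg\Box\neg\phi$; * b1: $\Box(\phi\to\psi)\to(\Box\neg\phi\vee\Box(\psi|\phi))$; * b2: $(\psi\to\eta|\phi)\to((\psi|\phi)\to(\eta|\phi))$; * b3: $(\psi|\phi)\to(\phi\to\psi)$; * b4: $\neg(\neg\psi|\phi)\equiv(\psi|\phi)$; * b5: $\psi\times\phi\equiv\Box((\psi|\phi)\leftrightarrow\psi)$; * b6: $\psi\times\phi\equiv\phi\times\psi$. The logic DmBL$_*$ is obtained by replacing b6 by the two schemes $\psi\times\neg\phi\equiv\psi\times\phi$ and $\Box(\psi\leftrightarrow\eta)\to\Box((\phi|\psi)\leftrightarrow(\phi|\eta))$. A probability over $C$ is a function $\pi:\mathcal L_C\to[0,\infty)$ such that, for all $\phi,\psi\in\mathcal L_C$: $\phi\equiv_C\psi$ implies $\pi(\phi)=\pi(\psi)$; $\pi(\phi\wedge\psi)+\pi(\phi\vee\psi)=\pi(\phi)+\pi(\psi)$;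 $\pi(\bot)=0$; $\pi(\top)=1$. A (multiplicative) probability over DmBL (resp. DmBL$_*$) is a function $P:\mathcal L\to[0,\infty)$ with the same four properties for all $\phi,\psi\in\mathcal L$, with $\equiv$ of DmBL (resp. DmBL$_*$) in place of $\equiv_C$, and such that moreover $\vdash\phi\times\psi$ implies $P(\phi\wedge\psi)=P(\phi)P(\psi)$. **Theorem.** Let $\pi$ be any probability over $C$ (no positivity is assumed). Then 1. there is a multiplicative probability $P$ over DmBL$_*$ such that $P(\phi)=\pi(\phi)$ for every $\phi\in\mathcal L_C$; 2. there is a multiplicative probability $P$ over DmBL such that $P(\phi)=\pi(\phi)$ for every $\phi\in\mathcal L_C$. -/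

import Mathlib

open scoped NNReal

namespace DmBL

universe u

/-- The classical language over a set of atomic propositions. -/
inductive CForm (Θ : Type u) : Type u
  | atom : Θ → CForm Θ
  | bot : CForm Θ
  | top : CForm Θ
  | neg : CForm Θ → CForm Θ
  | imp : CForm Θ → CForm Θ → CForm Θ
  | and : CForm Θ → CForm Θ → CForm Θ
  | or : CForm Θ → CForm Θ → CForm Θ

/-- The full language: classical connectives, the two modalities, the conditional and the
logical independence. `cond ψ φ` is the conditional `(ψ|φ)`, and `indep ψ φ` is `ψ × φ`. -/
inductive Form (Θ : Type u) : Type u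
  | atom : Θ → Form Θ
  | bot : Form Θ
  | top : Form Θ
  | neg : Form Θ → Form Θ
  | box : Form Θ → Form Θ
  | dia : Form Θ → Form Θ
  | imp : Form Θ → Form Θ → Form Θ
  | and : Form Θ → Form Θ → Form Θ
  | or : Form Θ → Form Θ → Form Θ
  | cond : Form Θ → Form Θ → Form Θ
  | indep : Form Θ → Form Θ → Form Θ

namespace CForm

/-- The abbreviation `φ ↔ ψ` for `(φ → ψ) ∧ (ψ → φ)`. -/
def iff {Θ : Type u} (φ ψ : CForm Θ) : CForm Θ := and (imp φ ψ) (imp ψ φ)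

/-- The inclusion of the classical language in the full language. -/
def toForm {Θ : Type u} : CForm Θ → Form Θ
  | atom θ => .atom θ
  | bot => .bot
  | top => .top
  | neg φ => .neg φ.toForm
  | imp φ ψ => .imp φ.toForm ψ.toForm
  | and φ ψ => .and φ.toForm ψ.toForm
  | or φ ψ => .or φ.toForm ψ.toForm

/-- Provability in the classical logic `C`. An axiom that asserts an equivalence is given
as the two implications. -/
inductive Provable {Θ : Type u} : CForm Θ → Prop
  | c1 : Provable top
  | c2 (φ ψ : CForm Θ) : Provable (imp φ (imp ψ φ))
  | c3 (η φ ψ : CForm Θ) :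
      Provable (imp (imp η (imp φ ψ)) (imp (imp η φ) (imp η ψ)))
  | c4 (φ ψ : CForm Θ) :
      Provable (imp (imp (neg φ) (neg ψ)) (imp (imp (neg φ) ψ) φ))
  | c5 : Provable (imp bot (neg top))
  | c5_conv : Provable (imp (neg top) bot)
  | c6 (φ ψ : CForm Θ) : Provable (imp (imp φ ψ) (or (neg φ) ψ))
  | c6_conv (φ ψ : CForm Θ) : Provable (imp (or (neg φ) ψ) (imp φ ψ))
  | c7 (φ ψ : CForm Θ) : Provable (imp (and φ ψ) (neg (or (neg φ) (neg ψ))))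
  | c7_conv (φ ψ : CForm Θ) : Provable (imp (neg (or (neg φ) (neg ψ))) (and φ ψ))
  | mp {φ ψ : CForm Θ} : Provable φ → Provable (imp φ ψ) → Provable ψ

/-- A probability over the classical logic. -/
structure IsProbability {Θ : Type u} (π : CForm Θ → ℝ≥0) : Prop where
  equivalence : ∀ φ ψ : CForm Θ, Provable (iff φ ψ) → π φ = π ψ
  additivity : ∀ φ ψ : CForm Θ, π (and φ ψ) + π (or φ ψ) = π φ + π ψ
  coherence : π bot = 0
  finiteness : π top = 1

end CForm

namespace Form

/-- The abbreviation `φ ↔ ψ` for `(φ → ψ) ∧ (ψ → φ)`. -/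
def iff {Θ : Type u} (φ ψ : Form Θ) : Form Θ := and (imp φ ψ) (imp ψ φ)

/-- The axioms common to DmBL and its weakened version: the classical axioms, the axioms of
the modal system T, and the axioms b1 to b5 of the conditional and of the independence.
An axiom that asserts an equivalence is given as the two implications. -/
inductive CommonAxiom {Θ : Type u} : Form Θ → Prop
  | c1 : CommonAxiom top
  | c2 (φ ψ : Form Θ) : CommonAxiom (imp φ (imp ψ φ))
  | c3 (η φ ψ : Form Θ) :
      CommonAxiom (imp (imp η (imp φ ψ)) (imp (imp η φ) (imp η ψ)))
  | c4 (φ ψ : Form Θ) :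
      CommonAxiom (imp (imp (neg φ) (neg ψ)) (imp (imp (neg φ) ψ) φ))
  | c5 : CommonAxiom (imp bot (neg top))
  | c5_conv : CommonAxiom (imp (neg top) bot)
  | c6 (φ ψ : Form Θ) : CommonAxiom (imp (imp φ ψ) (or (neg φ) ψ))
  | c6_conv (φ ψ : Form Θ) : CommonAxiom (imp (or (neg φ) ψ) (imp φ ψ))
  | c7 (φ ψ : Form Θ) : CommonAxiom (imp (and φ ψ) (neg (or (neg φ) (neg ψ))))
  | c7_conv (φ ψ : Form Θ) : CommonAxiom (imp (neg (or (neg φ) (neg ψ))) (and φ ψ))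
  | m2 (φ ψ : Form Θ) : CommonAxiom (imp (box (imp φ ψ)) (imp (box φ) (box ψ)))
  | m3 (φ : Form Θ) : CommonAxiom (imp (box φ) φ)
  | m4 (φ : Form Θ) : CommonAxiom (imp (dia φ) (neg (box (neg φ))))
  | m4_conv (φ : Form Θ) : CommonAxiom (imp (neg (box (neg φ))) (dia φ))
  | b1 (φ ψ : Form Θ) :
      CommonAxiom (imp (box (imp φ ψ)) (or (box (neg φ)) (box (cond ψ φ))))
  | b2 (φ ψ η : Form Θ) :
      CommonAxiom (imp (cond (imp ψ η) φ) (imp (cond ψ φ) (cond η φ)))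
  | b3 (φ ψ : Form Θ) : CommonAxiom (imp (cond ψ φ) (imp φ ψ))
  | b4 (φ ψ : Form Θ) : CommonAxiom (imp (neg (cond (neg ψ) φ)) (cond ψ φ))
  | b4_conv (φ ψ : Form Θ) : CommonAxiom (imp (cond ψ φ) (neg (cond (neg ψ) φ)))
  | b5 (φ ψ : Form Θ) : CommonAxiom (imp (indep ψ φ) (box (iff (cond ψ φ) ψ)))
  | b5_conv (φ ψ : Form Θ) : CommonAxiom (imp (box (iff (cond ψ φ) ψ)) (indep ψ φ))

/-- The axioms of DmBL: the common ones and b6, the symmetry of the independence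
(the converse implication is the instance with `φ` and `ψ` exchanged). -/
inductive FullAxiom {Θ : Type u} : Form Θ → Prop
  | common {φ : Form Θ} : CommonAxiom φ → FullAxiom φ
  | b6 (φ ψ : Form Θ) : FullAxiom (imp (indep ψ φ) (indep φ ψ))

/-- The axioms of the weakened logic DmBL∗: the common ones and the two weak
substitutes for b6. -/
inductive StarAxiom {Θ : Type u} : Form Θ → Prop
  | common {φ : Form Θ} : CommonAxiom φ → StarAxiom φ
  | b6_weak_A (φ ψ : Form Θ) : StarAxiom (imp (indep ψ (neg φ)) (indep ψ φ))
  | b6_weak_A_conv (φ ψ : Form Θ) : StarAxiom (imp (indep ψ φ) (indep ψ (neg φ)))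
  | b6_weak_B (φ ψ η : Form Θ) :
      StarAxiom (imp (box (iff ψ η)) (box (iff (cond φ ψ) (cond φ η))))

/-- Provability from a set of axioms by modus ponens and by the rule m1 (from `φ`
infer `□φ`). -/
inductive Provable {Θ : Type u} (Ax : Form Θ → Prop) : Form Θ → Prop
  | ax {φ : Form Θ} : Ax φ → Provable Ax φ
  | mp {φ ψ : Form Θ} : Provable Ax φ → Provable Ax (imp φ ψ) → Provable Ax ψ
  | m1 {φ : Form Θ} : Provable Ax φ → Provable Ax (box φ)

/-- A (multiplicative) probability over the logic with axioms `Ax`. -/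
structure IsProbability {Θ : Type u} (Ax : Form Θ → Prop) (P : Form Θ → ℝ≥0) : Prop where
  equivalence : ∀ φ ψ : Form Θ, Provable Ax (iff φ ψ) → P φ = P ψ
  additivity : ∀ φ ψ : Form Θ, P (and φ ψ) + P (or φ ψ) = P φ + P ψ
  coherence : P bot = 0
  finiteness : P top = 1
  multiplicativity : ∀ φ ψ : Form Θ, Provable Ax (indep φ ψ) → P (and φ ψ) = P φ * P ψ

end Form

end DmBL

/-! Both logics are sound for one class of models, `CondField`: a field of sets with a strictly
positive probability and a symmetric relation `Ind` that implies probabilistic independence, such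
that the sets independent of a given one form an algebra and every `t` has, for every nonempty `s`,
some `c` independent of `s` that agrees with `t` on `s`. Positivity makes `c` unique (`eq_of_ind`).
So conditioning by `s` is a Boolean homomorphism, it fixes exactly the sets independent of `s`, and
the axioms follow, with `□` read as truth everywhere.

Such a field is built from a finite space of full support. To condition by `a`, each point `x` is
paired with a random point on the other side of `a`, drawn in the class of `x` for the algebra of
sets independent of `a`. Sets of pairs stable under exchange become independent of `a`
(`mass_inter_of_sym`), and the set "the member of the pair lying in `a` lies in `b`" is the
conditional of `b` (`exists_conditional`). Old probabilities and independences survive. Treating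
every set in turn, and repeating countably often, gives the field; all stages are partitions of `ℕ`,
so the limit is a plain union.

Null sets are avoided by approximation: on a finite set `F` of formulas, `π` is a finite
distribution on the cells of `F` of positive probability. The models obtained for all `F` are then
combined by a limit along an ultrafilter, which preserves every clause required of a probability.

One peculiarity: the axioms constrain `φ ∨ ψ` only when `φ` is a negation. The other classical
disjunctions behave as atoms for `C`, so the models interpret them freely; their additivity is
inherited from `π`. -/

namespace DmBL

universe u v

open Set Filter Topology

/-! ### Weights on a finite set -/

section Mass

variable {ι : Type v} [Fintype ι]

/-- The total weight of a set. -/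
noncomputable def mass (w : ι → ℝ) (s : Set ι) : ℝ := ∑ i, s.indicator w i

theorem mass_univ (w : ι → ℝ) : mass w univ = ∑ i, w i := by simp [mass]

theorem mass_empty (w : ι → ℝ) : mass w ∅ = 0 := by simp [mass]

theorem mass_inter_add_union (w : ι → ℝ) (s t : Set ι) :
    mass w (s ∩ t) + mass w (s ∪ t) = mass w s + mass w t := by
  classical
  simp only [mass, ← Finset.sum_add_distrib]
  refine Finset.sum_congr rfl fun i _ => ?_
  by_cases hs : i ∈ s <;> by_cases ht : i ∈ t <;> simp [hs, ht]

theorem mass_inter_add_inter_compl (w : ι → ℝ) (s t : Set ι) :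
    mass w (s ∩ t) + mass w (s ∩ tᶜ) = mass w s := by
  classical
  simp only [mass, ← Finset.sum_add_distrib]
  refine Finset.sum_congr rfl fun i _ => ?_
  by_cases hs : i ∈ s <;> by_cases ht : i ∈ t <;> simp [hs, ht]

theorem mass_pos {w : ι → ℝ} (hw : ∀ i, 0 < w i) {s : Set ι} (hs : s.Nonempty) :
    0 < mass w s := by
  obtain ⟨x, hx⟩ := hs
  refine Finset.sum_pos' (fun i _ => indicator_nonneg (fun i _ => (hw i).le) i)
    ⟨x, Finset.mem_univ x, ?_⟩
  simpa [hx] using hw x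

theorem mass_compl {w : ι → ℝ} (h : ∑ i, w i = 1) (s : Set ι) : mass w sᶜ = 1 - mass w s := by
  have := mass_inter_add_inter_compl w univ s
  rw [univ_inter, univ_inter, mass_univ, h] at this
  linarith

end Mass

/-! ### Finite spaces with independence, and the classes of a set -/

/-- A finite probability space of full support, with a symmetric relation of independence
such that the sets independent of a given one form an algebra. -/
structure IndepSpace (ι : Type v) [Fintype ι] where
  w : ι → ℝ
  w_pos : ∀ i, 0 < w i
  w_sum : ∑ i, w i = 1
  Ind : Set ι → Set ι → Prop
  ind_symm : ∀ {s t}, Ind s t → Ind t s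
  ind_univ : ∀ s, Ind s univ
  ind_compl : ∀ {s t}, Ind s t → Ind s tᶜ
  ind_inter : ∀ {s t u}, Ind s t → Ind s u → Ind s (t ∩ u)
  ind_mass : ∀ {s t}, Ind s t → mass w (s ∩ t) = mass w s * mass w t

namespace IndepSpace

variable {ι : Type v} [Fintype ι] (S : IndepSpace ι) (a : Set ι)

theorem ind_sInter {a : Set ι} {T : Set (Set ι)} (h : ∀ s ∈ T, S.Ind a s) :
    S.Ind a (⋂₀ T) := by
  induction T, T.toFinite using Set.Finite.induction_on with
  | empty => simpa using S.ind_univ a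
  | @insert s T _ _ ih =>
    rw [sInter_insert]
    exact S.ind_inter (h s (mem_insert s T)) (ih fun t ht => h t (mem_insert_of_mem s ht))

theorem ind_sUnion {a : Set ι} {T : Set (Set ι)} (h : ∀ s ∈ T, S.Ind a s) :
    S.Ind a (⋃₀ T) := by
  rw [← compl_compl (⋃₀ T), compl_sUnion]
  refine S.ind_compl (S.ind_sInter ?_)
  rintro _ ⟨s, hs, rfl⟩
  exact S.ind_compl (h s hs)

/-- The points that no set independent of `a` separates from `x`. -/
def cls (x : ι) : Set ι := {y | ∀ s, S.Ind a s → (x ∈ s ↔ y ∈ s)}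

theorem mem_cls_self (x : ι) : x ∈ S.cls a x := fun _ _ => Iff.rfl

variable {S a} in
theorem mem_cls_symm {x y : ι} (h : y ∈ S.cls a x) : x ∈ S.cls a y :=
  fun s hs => (h s hs).symm

variable {S a} in
theorem mem_cls_trans {x y z : ι} (h : y ∈ S.cls a x) (h' : z ∈ S.cls a y) : z ∈ S.cls a x :=
  fun s hs => (h s hs).trans (h' s hs)

variable {S a} in
theorem cls_eq {x y : ι} (h : y ∈ S.cls a x) : S.cls a y = S.cls a x :=
  Set.ext fun _ => ⟨mem_cls_trans h, mem_cls_trans (mem_cls_symm h)⟩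

/-- Closure under complement makes the class the intersection of the independent sets that contain
`x`, and finiteness makes this a finite intersection. -/
theorem ind_cls (x : ι) : S.Ind a (S.cls a x) := by
  have : S.cls a x = ⋂₀ {s | S.Ind a s ∧ x ∈ s} := by
    ext y
    simp only [mem_sInter, mem_ofPred_eq, cls]
    refine ⟨fun h s hs => (h s hs.1).1 hs.2, fun h s hs => ⟨fun hx => h s ⟨hs, hx⟩, fun hy => ?_⟩⟩
    by_contra hx
    exact h sᶜ ⟨S.ind_compl hs, hx⟩ hy
  rw [this]
  exact S.ind_sInter fun s hs => hs.1

theorem ind_of_saturated {t : Set ι} (h : ∀ x y, y ∈ S.cls a x → x ∈ t → y ∈ t) :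
    S.Ind a t := by
  have : t = ⋃₀ (S.cls a '' t) := by
    ext y
    simp only [sUnion_image, mem_iUnion, exists_prop]
    exact ⟨fun hy => ⟨y, hy, S.mem_cls_self a y⟩, fun ⟨x, hx, hy⟩ => h x y hy hx⟩
  rw [this]
  refine S.ind_sUnion ?_
  rintro _ ⟨x, _, rfl⟩
  exact S.ind_cls a x

/-- The points of the class of `x` on the other side of `a`. -/
def opp (x : ι) : Set ι := {y | y ∈ S.cls a x ∧ (y ∈ a ↔ x ∉ a)}

variable {S a} in
theorem mem_opp_symm {x y : ι} (h : y ∈ S.opp a x) : x ∈ S.opp a y :=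
  ⟨mem_cls_symm h.1, by have := h.2; tauto⟩

theorem opp_of_mem {x : ι} (hx : x ∈ a) : S.opp a x = aᶜ ∩ S.cls a x := by
  ext y; simp [opp, hx, and_comm]

theorem opp_of_notMem {x : ι} (hx : x ∉ a) : S.opp a x = a ∩ S.cls a x := by
  ext y; simp [opp, hx, and_comm]

theorem mass_inter_cls (x : ι) :
    mass S.w (a ∩ S.cls a x) = mass S.w a * mass S.w (S.cls a x) :=
  S.ind_mass (S.ind_cls a x)

theorem mass_compl_inter_cls (x : ι) :
    mass S.w (aᶜ ∩ S.cls a x) = (1 - mass S.w a) * mass S.w (S.cls a x) := by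
  rw [← mass_compl S.w_sum]
  exact S.ind_mass (S.ind_symm (S.ind_compl (S.ind_symm (S.ind_cls a x))))

theorem mass_cls_pos (x : ι) : 0 < mass S.w (S.cls a x) :=
  mass_pos S.w_pos ⟨x, S.mem_cls_self a x⟩

/-- The set `a` is neither empty nor everything. -/
def Proper (a : Set ι) : Prop := a.Nonempty ∧ aᶜ.Nonempty

variable {a} (ha : Proper a)
include ha

/-- The class of `x` is independent of `a`, so `a` splits it in the same proportion as the whole
space. -/
theorem mass_opp_pos (x : ι) : 0 < mass S.w (S.opp a x) := by
  have h1 := mass_pos S.w_pos ha.1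
  have h2 := mass_pos S.w_pos ha.2
  rw [mass_compl S.w_sum] at h2
  have h3 := S.mass_cls_pos a x
  by_cases hx : x ∈ a
  · rw [S.opp_of_mem a hx, mass_compl_inter_cls]; positivity
  · rw [S.opp_of_notMem a hx, mass_inter_cls]; positivity

theorem opp_nonempty (x : ι) : (S.opp a x).Nonempty := by
  by_contra h
  have := S.mass_opp_pos ha x
  rw [not_nonempty_iff_eq_empty.1 h, mass_empty] at this
  exact lt_irrefl _ this

/-! ### The space of pairs and its exchange -/

omit ha
variable (a)

/-- The pairs of points of a same class on opposite sides of `a`. -/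
def Pair : Type v := {q : ι × ι // q.2 ∈ S.opp a q.1}

noncomputable instance : Fintype (S.Pair a) := by
  classical exact Subtype.fintype _

variable {S a}

/-- The first point of a pair. -/
def Pair.fst (q : S.Pair a) : ι := q.1.1

/-- The second point of a pair. -/
def Pair.snd (q : S.Pair a) : ι := q.1.2

/-- The exchange of the two points of a pair. -/
def Pair.swap : S.Pair a ≃ S.Pair a where
  toFun q := ⟨(q.snd, q.fst), mem_opp_symm q.2⟩
  invFun q := ⟨(q.snd, q.fst), mem_opp_symm q.2⟩
  left_inv _ := rfl
  right_inv _ := rfl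

theorem Pair.snd_mem_opp (q : S.Pair a) : q.snd ∈ S.opp a q.fst := q.2

theorem Pair.snd_mem_iff (q : S.Pair a) : q.snd ∈ a ↔ q.fst ∉ a := q.2.2

theorem Pair.fst_surjective (ha : Proper a) : Function.Surjective (Pair.fst : S.Pair a → ι) :=
  fun x => let ⟨y, hy⟩ := S.opp_nonempty ha x; ⟨⟨(x, y), hy⟩, rfl⟩

/-- The weight of a pair: the second point is drawn at random among those on the other side. -/
noncomputable def Pair.weight (q : S.Pair a) : ℝ :=
  S.w q.fst * S.w q.snd / mass S.w (S.opp a q.fst)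

theorem Pair.weight_pos (ha : Proper a) (q : S.Pair a) : 0 < q.weight :=
  div_pos (mul_pos (S.w_pos _) (S.w_pos _)) (S.mass_opp_pos ha _)

/-- For a fixed first point, the conditional weights of the second sum to one, so the first marginal
is the old measure. -/
theorem mass_preimage_fst (ha : Proper a) (s : Set ι) :
    mass (Pair.weight (S := S) (a := a)) (Pair.fst ⁻¹' s) = mass S.w s := by
  classical
  have h1 : mass (Pair.weight (S := S) (a := a)) (Pair.fst ⁻¹' s) =
      ∑ q : ι × ι, if q.2 ∈ S.opp a q.1 then
        s.indicator (fun x => S.w x * S.w q.2 / mass S.w (S.opp a x)) q.1 else 0 := by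
    rw [← Finset.sum_filter]
    exact (Finset.sum_subtype (p := fun q : ι × ι => q.2 ∈ S.opp a q.1)
      (F := (inferInstance : Fintype (S.Pair a)))
      (Finset.univ.filter fun q : ι × ι => q.2 ∈ S.opp a q.1)
      (fun _ => by rw [Finset.mem_filter_univ])
      (fun q => s.indicator (fun x => S.w x * S.w q.2 / mass S.w (S.opp a x)) q.1)).symm
  rw [h1, Fintype.sum_prod_type]
  refine Finset.sum_congr rfl fun x _ => ?_
  by_cases hx : x ∈ s
  · simp only [hx, indicator_of_mem]
    have h2 : ∀ y, (if y ∈ S.opp a x then S.w x * S.w y / mass S.w (S.opp a x) else 0) =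
        (S.w x / mass S.w (S.opp a x)) * (S.opp a x).indicator S.w y := by
      intro y
      by_cases hy : y ∈ S.opp a x
      · simp only [hy, if_true, indicator_of_mem]; ring
      · simp [hy]
    rw [Finset.sum_congr rfl fun y _ => h2 y, ← Finset.mul_sum]
    exact div_mul_cancel₀ _ (S.mass_opp_pos ha x).ne'
  · simp [hx]

/-- The two weights differ only in the mass of the opposite side, and both sides lie in one class,
whose mass cancels. The ratio is thus the same for all pairs that start in `a`. -/
theorem Pair.weight_swap (ha : Proper a) (q : S.Pair a) (hq : q.fst ∈ a) :
    mass S.w a * q.swap.weight = (1 - mass S.w a) * q.weight := by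
  have hq' : q.snd ∉ a := fun h => (q.snd_mem_iff.1 h) hq
  have h1 := mass_pos S.w_pos ha.1
  have h2 := mass_pos S.w_pos ha.2
  rw [mass_compl S.w_sum] at h2
  have h3 := S.mass_cls_pos a q.fst
  have e1 : q.weight = S.w q.fst * S.w q.snd / ((1 - mass S.w a) * mass S.w (S.cls a q.fst)) := by
    rw [Pair.weight, S.opp_of_mem a hq, mass_compl_inter_cls]
  have e2 : q.swap.weight = S.w q.snd * S.w q.fst / (mass S.w a * mass S.w (S.cls a q.fst)) := by
    change S.w q.snd * S.w q.fst / mass S.w (S.opp a q.snd) = _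
    rw [S.opp_of_notMem a hq', mass_inter_cls, cls_eq q.snd_mem_opp.1]
  rw [e1, e2]
  field_simp

/-- Sets of pairs that are stable under exchange. -/
def Sym (T : Set (S.Pair a)) : Prop := ∀ q, q.swap ∈ T ↔ q ∈ T

/-- Exchange carries the part of `T` that starts in `a` onto the part that starts outside,
multiplying weights by a constant. -/
theorem mass_inter_of_sym (ha : Proper a) {T : Set (S.Pair a)} (hT : Sym T) :
    mass Pair.weight (Pair.fst ⁻¹' a ∩ T) = mass S.w a * mass Pair.weight T := by
  have key : mass S.w a * mass Pair.weight (T ∩ (Pair.fst ⁻¹' a)ᶜ) =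
      (1 - mass S.w a) * mass Pair.weight (T ∩ Pair.fst ⁻¹' a) := by
    rw [show mass Pair.weight (T ∩ (Pair.fst ⁻¹' a)ᶜ) = _ from
      (Equiv.sum_comp Pair.swap _).symm, show mass Pair.weight (T ∩ Pair.fst ⁻¹' a) =
        ∑ q, (T ∩ Pair.fst ⁻¹' a).indicator Pair.weight q from rfl,
      Finset.mul_sum, Finset.mul_sum]
    refine Finset.sum_congr rfl fun q _ => ?_
    by_cases hq : q ∈ T ∩ Pair.fst ⁻¹' a
    · have : q.swap ∈ T ∩ (Pair.fst ⁻¹' a)ᶜ :=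
        ⟨(hT q).2 hq.1, fun h => (q.snd_mem_iff.1 h) hq.2⟩
      rw [indicator_of_mem hq, indicator_of_mem this, q.weight_swap ha hq.2]
    · have : q.swap ∉ T ∩ (Pair.fst ⁻¹' a)ᶜ := fun h =>
        hq ⟨(hT q).1 h.1, by_contra fun h' => h.2 (q.snd_mem_iff.2 h')⟩
      rw [indicator_of_notMem hq, indicator_of_notMem this]; simp
  have := mass_inter_add_inter_compl Pair.weight T (Pair.fst ⁻¹' a)
  rw [inter_comm, ← this]
  linarith

theorem Sym.compl {T : Set (S.Pair a)} (h : Sym T) : Sym Tᶜ := fun q => not_congr (h q)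

theorem Sym.inter {T U : Set (S.Pair a)} (h : Sym T) (h' : Sym U) : Sym (T ∩ U) :=
  fun q => and_congr (h q) (h' q)

/-- Two points of a class on opposite sides of `a` form a pair, and two on the same side are linked
through an opposite one. Hence a symmetric preimage comes from a union of classes. -/
theorem sym_preimage_iff (ha : Proper a) (s : Set ι) :
    Sym (Pair.fst ⁻¹' s : Set (S.Pair a)) ↔ S.Ind a s := by
  constructor
  · intro h
    have h' : ∀ x y, y ∈ S.opp a x → (y ∈ s ↔ x ∈ s) := fun x y hy => h ⟨(x, y), hy⟩
    refine S.ind_of_saturated a fun x y hxy hx => ?_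
    by_cases hside : (y ∈ a ↔ x ∈ a)
    · obtain ⟨z, hz⟩ := S.opp_nonempty ha x
      have hz' : y ∈ S.opp a z :=
        ⟨mem_cls_trans (mem_cls_symm hz.1) hxy, by have := hz.2; tauto⟩
      exact (h' z y hz').2 ((h' x z hz).2 hx)
    · exact (h' x y ⟨hxy, by tauto⟩).2 hx
  · intro h q
    exact (q.snd_mem_opp.1 s h).symm

theorem not_sym_preimage_self (ha : Proper a) : ¬ Sym (Pair.fst ⁻¹' a : Set (S.Pair a)) := by
  intro h
  obtain ⟨x, hx⟩ := ha.1
  obtain ⟨q, rfl⟩ := Pair.fst_surjective (S := S) ha x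
  exact q.snd_mem_iff.1 ((h q).2 hx) hx

/-! ### Independence on the space of pairs -/

/-- The sets `∅` and `univ`. -/
def Triv {X : Type v} (s : Set X) : Prop := s = ∅ ∨ s = univ

theorem Triv.compl {X : Type v} {s : Set X} (h : Triv s) : Triv sᶜ := by
  rcases h with rfl | rfl
  · right; simp
  · left; simp

theorem Triv.inter_cases {X : Type v} {s : Set X} (h : Triv s) (t : Set X) :
    s ∩ t = ∅ ∨ s ∩ t = t := by
  rcases h with rfl | rfl <;> simp

/-- The preimage of `a` and its complement. -/
def Base (T : Set (S.Pair a)) : Prop := T = Pair.fst ⁻¹' a ∨ T = (Pair.fst ⁻¹' a)ᶜ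

theorem Base.compl {T : Set (S.Pair a)} (h : Base T) : Base Tᶜ := by
  rcases h with rfl | rfl
  · right; rfl
  · left; simp

/-- The independence on pairs: the former one, that of `a` and the symmetric sets, and the
trivial one. -/
inductive PairInd : Set (S.Pair a) → Set (S.Pair a) → Prop
  | old {s t : Set ι} : S.Ind s t → PairInd (Pair.fst ⁻¹' s) (Pair.fst ⁻¹' t)
  | left {T U : Set (S.Pair a)} : Base T → Sym U → PairInd T U
  | right {T U : Set (S.Pair a)} : Sym T → Base U → PairInd T U
  | trivLeft {T U : Set (S.Pair a)} : Triv T → PairInd T U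
  | trivRight {T U : Set (S.Pair a)} : Triv U → PairInd T U

theorem PairInd.symm {T U : Set (S.Pair a)} (h : PairInd T U) : PairInd U T := by
  cases h with
  | old h => exact .old (S.ind_symm h)
  | left h h' => exact .right h' h
  | right h h' => exact .left h' h
  | trivLeft h => exact .trivRight h
  | trivRight h => exact .trivLeft h

theorem PairInd.compl {T U : Set (S.Pair a)} (h : PairInd T U) : PairInd T Uᶜ := by
  cases h with
  | old h => exact .old (S.ind_compl h)
  | left h h' => exact .left h h'.compl
  | right h h' => exact .right h h'.compl
  | trivLeft h => exact .trivLeft h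
  | trivRight h => exact .trivRight h.compl

theorem Triv.sym {T : Set (S.Pair a)} (h : Triv T) : Sym T := by
  rcases h with rfl | rfl <;> intro q <;> simp

theorem Base.not_sym (ha : Proper a) {T : Set (S.Pair a)} (h : Base T) : ¬ Sym T := by
  rcases h with rfl | rfl
  · exact not_sym_preimage_self ha
  · intro h; exact not_sym_preimage_self ha (by simpa using h.compl)

theorem ind_empty (S : IndepSpace ι) (s : Set ι) : S.Ind s ∅ := by
  simpa using S.ind_compl (S.ind_univ s)

theorem ind_compl_left {s t : Set ι} (h : S.Ind s t) : S.Ind sᶜ t :=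
  S.ind_symm (S.ind_compl (S.ind_symm h))

theorem pairInd_base_iff (ha : Proper a) {T U : Set (S.Pair a)} (hT : Base T) :
    PairInd T U ↔ Sym U := by
  refine ⟨fun h => ?_, .left hT⟩
  cases h with
  | @old s t h =>
    have hs : s = a ∨ s = aᶜ := by
      have hinj := (Pair.fst_surjective (S := S) ha).preimage_injective
      exact hT.imp (fun h => hinj h) (fun h => hinj h)
    rw [sym_preimage_iff ha]
    rcases hs with rfl | rfl
    · exact h
    · simpa using ind_compl_left h
  | left _ h => exact h
  | right h _ => exact absurd h (hT.not_sym ha)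
  | trivLeft h => exact absurd h.sym (hT.not_sym ha)
  | trivRight h => exact h.sym

/-- The rule `right` adds nothing here: if the preimage of `s` is symmetric, `s` was already
independent of `a`. -/
theorem pairInd_preimage_iff (ha : Proper a) {s : Set ι} (hs : ¬ Triv s)
    (hb : ¬ Base (Pair.fst ⁻¹' s : Set (S.Pair a))) {U : Set (S.Pair a)} :
    PairInd (Pair.fst ⁻¹' s) U ↔ ∃ t, S.Ind s t ∧ U = Pair.fst ⁻¹' t := by
  have hsurj := Pair.fst_surjective (S := S) ha
  constructor
  · intro h
    generalize hV : (Pair.fst ⁻¹' s : Set (S.Pair a)) = V at h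
    cases h with
    | @old s' t h =>
      obtain rfl : s = s' := hsurj.preimage_injective hV
      exact ⟨t, h, rfl⟩
    | left h _ => exact absurd (hV ▸ h) hb
    | right h h' =>
      subst hV
      have := S.ind_symm ((sym_preimage_iff ha s).1 h)
      rcases h' with rfl | rfl
      · exact ⟨a, this, rfl⟩
      · exact ⟨aᶜ, S.ind_compl this, rfl⟩
    | trivLeft h =>
      subst hV
      refine absurd ?_ hs
      rcases h with h | h
      · left; exact hsurj.preimage_injective (by simpa using h)
      · right; exact hsurj.preimage_injective (by simpa using h)
    | trivRight h =>
      rcases h with rfl | rfl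
      · exact ⟨∅, ind_empty S s, by simp⟩
      · exact ⟨univ, S.ind_univ s, by simp⟩
  · rintro ⟨t, h, rfl⟩
    exact .old h

theorem pairInd_of_not_range {T U : Set (S.Pair a)}
    (hT : ∀ s : Set ι, T ≠ Pair.fst ⁻¹' s) (h : PairInd T U) : Triv U ∨ Sym T ∧ Base U := by
  cases h with
  | @old s t h => exact absurd rfl (hT s)
  | left h _ => rcases h with h | h
                · exact absurd h (hT a)
                · exact absurd h (hT aᶜ)
  | right h h' => exact .inr ⟨h, h'⟩
  | trivLeft h => rcases h with h | h
                  · exact absurd h (hT ∅)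
                  · exact absurd h (hT univ)
  | trivRight h => exact .inl h

theorem Triv.inter_pairInd {T U V : Set (S.Pair a)} (h : Triv U) (hV : PairInd T V) :
    PairInd T (U ∩ V) := by
  rcases h.inter_cases V with e | e <;> rw [e]
  · exact .trivRight (.inl rfl)
  · exact hV

theorem Base.inter_triv_or {U V : Set (S.Pair a)} (hU : Base U) (hV : Base V) :
    Triv (U ∩ V) ∨ Base (U ∩ V) := by
  rcases hU with rfl | rfl <;> rcases hV with rfl | rfl
  · right; left; simp
  · left; left; simp
  · left; left; simp
  · right; right; simp

/-- The sets independent of a nontrivial `T` are the symmetric sets if `T` is the preimage of `a` or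
of its complement, the preimages of old independent sets if `T` is another preimage, and otherwise
at most the four sets generated by the preimage of `a`. Each family is stable under intersection. -/
theorem PairInd.inter (ha : Proper a) {T U V : Set (S.Pair a)} (h : PairInd T U)
    (h' : PairInd T V) : PairInd T (U ∩ V) := by
  by_cases hT : Triv T
  · exact .trivLeft hT
  by_cases hb : Base T
  · rw [pairInd_base_iff ha hb] at h h' ⊢
    exact h.inter h'
  by_cases hr : ∃ s : Set ι, T = Pair.fst ⁻¹' s
  · obtain ⟨s, rfl⟩ := hr
    have hs : ¬ Triv s := by
      rintro (rfl | rfl)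
      · exact hT (.inl rfl)
      · exact hT (.inr rfl)
    rw [pairInd_preimage_iff ha hs hb] at h h' ⊢
    obtain ⟨t, ht, rfl⟩ := h
    obtain ⟨t', ht', rfl⟩ := h'
    exact ⟨t ∩ t', S.ind_inter ht ht', rfl⟩
  · push Not at hr
    rcases pairInd_of_not_range hr h with hU | ⟨hs, hU⟩
    · exact hU.inter_pairInd h'
    rcases pairInd_of_not_range hr h' with hV | ⟨_, hV⟩
    · rw [inter_comm]; exact hV.inter_pairInd h
    · exact (hU.inter_triv_or hV).elim .trivRight (.right hs)

theorem sum_pair_weight (ha : Proper a) : ∑ q : S.Pair a, q.weight = 1 := by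
  have := mass_preimage_fst (S := S) ha univ
  rwa [preimage_univ, mass_univ, mass_univ, S.w_sum] at this

theorem mass_base_inter_sym (ha : Proper a) {T U : Set (S.Pair a)} (hT : Base T) (hU : Sym U) :
    mass Pair.weight (T ∩ U) = mass Pair.weight T * mass Pair.weight U := by
  have h := mass_inter_of_sym ha hU
  rcases hT with rfl | rfl
  · rw [h, mass_preimage_fst ha]
  · have h2 := mass_inter_add_inter_compl Pair.weight U (Pair.fst ⁻¹' a)
    rw [mass_compl (sum_pair_weight ha), mass_preimage_fst ha, inter_comm]
    rw [inter_comm, h] at h2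
    linarith

theorem mass_triv_inter (ha : Proper a) {T U : Set (S.Pair a)} (hT : Triv T) :
    mass Pair.weight (T ∩ U) = mass Pair.weight T * mass Pair.weight U := by
  rcases hT with rfl | rfl
  · simp [mass_empty]
  · simp [mass_univ, sum_pair_weight ha]

theorem PairInd.mass_inter (ha : Proper a) {T U : Set (S.Pair a)} (h : PairInd T U) :
    mass Pair.weight (T ∩ U) = mass Pair.weight T * mass Pair.weight U := by
  cases h with
  | old h =>
    rw [← preimage_inter, mass_preimage_fst ha, mass_preimage_fst ha, mass_preimage_fst ha,
      S.ind_mass h]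
  | left h h' => exact mass_base_inter_sym ha h h'
  | right h h' => rw [inter_comm, mul_comm]; exact mass_base_inter_sym ha h' h
  | trivLeft h => exact mass_triv_inter ha h
  | trivRight h => rw [inter_comm, mul_comm]; exact mass_triv_inter ha h

variable (S) in
/-- The space of pairs. -/
noncomputable def pairSpace (ha : Proper a) : IndepSpace (S.Pair a) where
  w := Pair.weight
  w_pos := Pair.weight_pos ha
  w_sum := sum_pair_weight ha
  Ind := PairInd
  ind_symm := PairInd.symm
  ind_univ _ := .trivRight (.inr rfl)
  ind_compl := PairInd.compl
  ind_inter := PairInd.inter ha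
  ind_mass := PairInd.mass_inter ha

theorem pairSpace_ind_preimage_iff (ha : Proper a) {s t : Set ι} :
    (S.pairSpace ha).Ind (Pair.fst ⁻¹' s) (Pair.fst ⁻¹' t) ↔ S.Ind s t := by
  refine ⟨fun h => ?_, .old⟩
  by_cases hs : Triv s
  · rcases hs with rfl | rfl
    · exact S.ind_symm (ind_empty S t)
    · exact S.ind_symm (S.ind_univ t)
  by_cases hb : Base (Pair.fst ⁻¹' s : Set (S.Pair a))
  · have h1 := (sym_preimage_iff ha t).1 ((pairInd_base_iff ha hb).1 h)
    have hinj := (Pair.fst_surjective (S := S) ha).preimage_injective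
    rcases hb with hb | hb
    · rw [hinj hb]; exact h1
    · rw [show s = aᶜ from hinj hb]; exact ind_compl_left h1
  · obtain ⟨t', ht', e⟩ := (pairInd_preimage_iff ha hs hb).1 h
    rwa [(Pair.fst_surjective (S := S) ha).preimage_injective e]

/-- Exactly one point of each pair lies in `a`; the witness tests `b` at that point, which does not
depend on the order of the pair. -/
theorem exists_conditional (ha : Proper a) (b : Set ι) :
    ∃ C : Set (S.Pair a), (S.pairSpace ha).Ind (Pair.fst ⁻¹' a) C ∧
      C ∩ Pair.fst ⁻¹' a = Pair.fst ⁻¹' b ∩ Pair.fst ⁻¹' a := by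
  refine ⟨{q | q.fst ∈ a ∧ q.fst ∈ b ∨ q.snd ∈ a ∧ q.snd ∈ b}, .left (.inl rfl) ?_, ?_⟩
  · intro q
    exact or_comm
  · ext q
    have := q.snd_mem_iff
    simp only [mem_inter_iff, mem_ofPred_eq, mem_preimage]
    tauto

end IndepSpace

/-! ### Fields of sets with conditionals -/

/-- A field of sets with a strictly positive probability and a symmetric relation of
independence, in which every set can be conditioned by every nonempty one. -/
structure CondField (X : Type*) where
  Mem : Set X → Prop
  mem_univ : Mem univ
  mem_compl : ∀ {s}, Mem s → Mem sᶜ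
  mem_inter : ∀ {s t}, Mem s → Mem t → Mem (s ∩ t)
  P : Set X → ℝ
  P_univ : P univ = 1
  P_empty : P ∅ = 0
  P_add : ∀ {s t}, Mem s → Mem t → P (s ∩ t) + P (s ∪ t) = P s + P t
  P_pos : ∀ {s}, Mem s → s.Nonempty → 0 < P s
  Ind : Set X → Set X → Prop
  ind_symm : ∀ {s t}, Ind s t → Ind t s
  ind_univ : ∀ {s}, Mem s → Ind s univ
  ind_compl : ∀ {s t}, Ind s t → Ind s tᶜ
  ind_inter : ∀ {s t u}, Ind s t → Ind s u → Ind s (t ∩ u)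
  ind_mul : ∀ {s t}, Ind s t → P (s ∩ t) = P s * P t
  ind_mem : ∀ {s t}, Ind s t → Mem t
  exists_cond : ∀ {s t}, Mem s → Mem t → s.Nonempty → ∃ c, Ind s c ∧ c ∩ s = t ∩ s

namespace CondField

variable {X : Type*} (M : CondField X) {s t u c : Set X}

theorem ind_union (h : M.Ind s t) (h' : M.Ind s u) : M.Ind s (t ∪ u) := by
  rw [← compl_compl (t ∪ u), compl_union]
  exact M.ind_compl (M.ind_inter (M.ind_compl h) (M.ind_compl h'))

theorem mem_empty : M.Mem ∅ := by simpa using M.mem_compl M.mem_univ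

theorem mem_union (hs : M.Mem s) (ht : M.Mem t) : M.Mem (s ∪ t) := by
  rw [← compl_compl (s ∪ t), compl_union]
  exact M.mem_compl (M.mem_inter (M.mem_compl hs) (M.mem_compl ht))

theorem P_nonneg (hs : M.Mem s) : 0 ≤ M.P s := by
  rcases s.eq_empty_or_nonempty with h | h
  · rw [h, M.P_empty]
  · exact (M.P_pos hs h).le

theorem P_mem_Icc (hs : M.Mem s) : M.P s ∈ Icc (0 : ℝ) 1 := by
  refine ⟨M.P_nonneg hs, ?_⟩
  have h1 := M.P_add hs (M.mem_compl hs)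
  rw [inter_compl_self, union_compl_self, M.P_empty, M.P_univ] at h1
  have h2 := M.P_nonneg (M.mem_compl hs)
  linarith

theorem ind_empty_left (ht : M.Mem t) : M.Ind ∅ t := by
  simpa using M.ind_symm (M.ind_compl (M.ind_univ ht))

/-- The difference `t ∩ uᶜ` is independent of `s` and disjoint from it, so the product of their
probabilities is zero; strict positivity then forces it to be empty. -/
theorem subset_of_ind (hs : M.Mem s) (hne : s.Nonempty) (ht : M.Ind s t) (hu : M.Ind s u)
    (h : t ∩ s ⊆ u) : t ⊆ u := by
  by_contra hn
  have h1 : M.Ind s (t ∩ uᶜ) := M.ind_inter ht (M.ind_compl hu)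
  have h2 : (t ∩ uᶜ).Nonempty := by
    obtain ⟨x, hx, hx'⟩ := not_subset.1 hn
    exact ⟨x, hx, hx'⟩
  have h3 : s ∩ (t ∩ uᶜ) = ∅ := by
    ext x
    simp only [mem_inter_iff, mem_compl_iff, mem_empty_iff_false, iff_false]
    exact fun hx => hx.2.2 (h ⟨hx.2.1, hx.1⟩)
  have h4 := M.ind_mul h1
  rw [h3, M.P_empty] at h4
  exact (mul_pos (M.P_pos hs hne) (M.P_pos (M.ind_mem h1) h2)).ne h4

theorem eq_of_ind (hs : M.Mem s) (hne : s.Nonempty) (ht : M.Ind s t) (hu : M.Ind s u)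
    (h : t ∩ s = u ∩ s) : t = u :=
  (M.subset_of_ind hs hne ht hu (h.le.trans inter_subset_left)).antisymm
    (M.subset_of_ind hs hne hu ht (h.ge.trans inter_subset_left))

open Classical in
/-- The conditional of `t` given `s`; it is `t` if `s` is empty. -/
noncomputable def cond (t s : Set X) : Set X :=
  if h : M.Mem s ∧ M.Mem t ∧ s.Nonempty then (M.exists_cond h.1 h.2.1 h.2.2).choose else t

theorem cond_empty : M.cond t ∅ = t := by simp [cond]

theorem ind_cond (hs : M.Mem s) (ht : M.Mem t) : M.Ind s (M.cond t s) := by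
  rcases s.eq_empty_or_nonempty with rfl | hne
  · rw [cond_empty]; exact M.ind_empty_left ht
  · rw [cond, dif_pos ⟨hs, ht, hne⟩]
    exact (M.exists_cond hs ht hne).choose_spec.1

theorem cond_inter (hs : M.Mem s) (ht : M.Mem t) : M.cond t s ∩ s = t ∩ s := by
  rcases s.eq_empty_or_nonempty with rfl | hne
  · simp
  · rw [cond, dif_pos ⟨hs, ht, hne⟩]
    exact (M.exists_cond hs ht hne).choose_spec.2

theorem cond_mem (hs : M.Mem s) (ht : M.Mem t) : M.Mem (M.cond t s) :=
  M.ind_mem (M.ind_cond hs ht)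

/-- This turns the axioms on `×` into properties of `Ind`. The default value of `cond` at `∅` is
chosen so that it also holds there, `∅` being independent of everything in the field. -/
theorem cond_eq_self_iff (hs : M.Mem s) (ht : M.Mem t) : M.cond t s = t ↔ M.Ind s t := by
  refine ⟨fun h => h ▸ M.ind_cond hs ht, fun h => ?_⟩
  rcases s.eq_empty_or_nonempty with rfl | hne
  · exact M.cond_empty
  · exact M.eq_of_ind hs hne (M.ind_cond hs ht) h (M.cond_inter hs ht)

theorem cond_eq_univ (hs : M.Mem s) (ht : M.Mem t) (hne : s.Nonempty) (h : s ⊆ t) :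
    M.cond t s = univ :=
  M.eq_of_ind hs hne (M.ind_cond hs ht) (M.ind_univ hs) (by
    rw [M.cond_inter hs ht, univ_inter, inter_eq_right.2 h])

theorem cond_compl (hs : M.Mem s) (ht : M.Mem t) : M.cond tᶜ s = (M.cond t s)ᶜ := by
  rcases s.eq_empty_or_nonempty with rfl | hne
  · simp [cond_empty]
  · refine M.eq_of_ind hs hne (M.ind_cond hs (M.mem_compl ht)) (M.ind_compl (M.ind_cond hs ht)) ?_
    rw [M.cond_inter hs (M.mem_compl ht)]
    ext x
    have := Set.ext_iff.1 (M.cond_inter hs ht) x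
    simp only [mem_inter_iff, mem_compl_iff] at this ⊢
    tauto

theorem cond_union (hs : M.Mem s) (ht : M.Mem t) (hu : M.Mem u) :
    M.cond (t ∪ u) s = M.cond t s ∪ M.cond u s := by
  rcases s.eq_empty_or_nonempty with rfl | hne
  · simp [cond_empty]
  · refine M.eq_of_ind hs hne (M.ind_cond hs (M.mem_union ht hu))
      (M.ind_union (M.ind_cond hs ht) (M.ind_cond hs hu)) ?_
    rw [M.cond_inter hs (M.mem_union ht hu), union_inter_distrib_right,
      union_inter_distrib_right, M.cond_inter hs ht, M.cond_inter hs hu]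

theorem ind_compl_left_iff : M.Ind sᶜ t ↔ M.Ind s t := by
  refine ⟨fun h => ?_, fun h => M.ind_symm (M.ind_compl (M.ind_symm h))⟩
  simpa using M.ind_symm (M.ind_compl (M.ind_symm h))

end CondField

/-! ### Interpretation of formulas and soundness -/

namespace Form

variable {Θ : Type u} {X : Type*} (M : CondField X) (V : CForm Θ → Set X)

/-- The disjunctions on which the classical axioms say nothing, among those of classical
formulas. -/
def FreeOr (φ ψ : Form Θ) : Prop :=
  (∀ χ, φ ≠ neg χ) ∧ ∃ c : CForm Θ, c.toForm = or φ ψ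

open Classical in
/-- The set of worlds at which a formula holds; the atoms and the free disjunctions are
interpreted by `V`. -/
noncomputable def eval : Form Θ → Set X
  | atom θ => V (.atom θ)
  | bot => ∅
  | top => univ
  | neg φ => (eval φ)ᶜ
  | box φ => {_x | eval φ = univ}
  | dia φ => {_x | eval φ ≠ ∅}
  | imp φ ψ => (eval φ)ᶜ ∪ eval ψ
  | and φ ψ => eval φ ∩ eval ψ
  | or φ ψ => if h : FreeOr φ ψ then V h.2.choose else eval φ ∪ eval ψ
  | cond ψ φ => M.cond (eval ψ) (eval φ)
  | indep ψ φ => {_x | M.cond (eval ψ) (eval φ) = eval ψ}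

theorem eval_or {φ ψ : Form Θ} (h : ¬ FreeOr φ ψ) :
    eval M V (or φ ψ) = eval M V φ ∪ eval M V ψ := by
  rw [eval, dif_neg h]

theorem eval_or_neg (φ ψ : Form Θ) : eval M V (or (neg φ) ψ) = (eval M V φ)ᶜ ∪ eval M V ψ := by
  rw [eval_or M V fun h => h.1 φ rfl, eval]

theorem eval_neg_or_neg (φ ψ : Form Θ) :
    eval M V (neg (or (neg φ) (neg ψ))) = eval M V (and φ ψ) := by
  rw [eval, eval_or_neg, eval, eval, compl_union, compl_compl, compl_compl]

theorem mem_setOf_const (p : Prop) : M.Mem {_x | p} := by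
  by_cases h : p
  · simpa [h] using M.mem_univ
  · simpa [h] using M.mem_empty

variable {V} (hV : ∀ q, M.Mem (V q))
include hV

theorem eval_mem (φ : Form Θ) : M.Mem (eval M V φ) := by
  induction φ with
  | atom θ => exact hV _
  | bot => exact M.mem_empty
  | top => exact M.mem_univ
  | neg φ ih => exact M.mem_compl ih
  | box φ ih => exact mem_setOf_const M _
  | dia φ ih => exact mem_setOf_const M _
  | imp φ ψ h1 h2 => exact M.mem_union (M.mem_compl h1) h2
  | and φ ψ h1 h2 => exact M.mem_inter h1 h2
  | or φ ψ h1 h2 =>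
    rw [eval]
    split_ifs
    · exact hV _
    · exact M.mem_union h1 h2
  | cond ψ φ h1 h2 => exact M.cond_mem h2 h1
  | indep ψ φ h1 h2 => exact mem_setOf_const M _

omit hV

theorem eval_imp_eq_univ {φ ψ : Form Θ} :
    eval M V (imp φ ψ) = univ ↔ eval M V φ ⊆ eval M V ψ := by
  simp only [eval, eq_univ_iff_forall, mem_union, mem_compl_iff, subset_def]
  exact forall_congr' fun x => by tauto

theorem eval_iff_eq_univ {φ ψ : Form Θ} :
    eval M V (iff φ ψ) = univ ↔ eval M V φ = eval M V ψ := by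
  rw [subset_antisymm_iff (a := eval M V φ), ← eval_imp_eq_univ M, ← eval_imp_eq_univ M]
  simp only [iff, eval, eq_univ_iff_forall, mem_inter_iff, forall_and]

theorem setOf_const_subset {p : Prop} {s : Set X} (h : p → s = univ) : {_x : X | p} ⊆ s :=
  fun _ hp => h hp ▸ mem_univ _

variable [Nonempty X]

theorem setOf_const_eq_univ {p : Prop} : ({_x | p} : Set X) = univ ↔ p := by
  by_cases h : p <;> simp [h, empty_ne_univ]

theorem eval_box_eq_univ {φ : Form Θ} : eval M V (box φ) = univ ↔ eval M V φ = univ :=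
  setOf_const_eq_univ

include hV

theorem eval_commonAxiom {φ : Form Θ} (h : CommonAxiom φ) : eval M V φ = univ := by
  have hm := eval_mem M hV
  cases h with
  | c1 => rfl
  | c2 φ ψ =>
    refine eval_imp_eq_univ M |>.2 fun x hx => ?_
    simp only [eval, mem_union, mem_compl_iff]; tauto
  | c3 η φ ψ =>
    refine eval_imp_eq_univ M |>.2 fun x hx => ?_
    simp only [eval, mem_union, mem_compl_iff] at hx ⊢; tauto
  | c4 φ ψ =>
    refine eval_imp_eq_univ M |>.2 fun x hx => ?_
    simp only [eval, mem_union, mem_compl_iff] at hx ⊢; tauto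
  | c5 => simp [eval]
  | c5_conv => simp [eval]
  | c6 φ ψ => exact (eval_imp_eq_univ M).2 (eval_or_neg M V φ ψ).ge
  | c6_conv φ ψ => exact (eval_imp_eq_univ M).2 (eval_or_neg M V φ ψ).le
  | c7 φ ψ => exact (eval_imp_eq_univ M).2 (eval_neg_or_neg M V φ ψ).ge
  | c7_conv φ ψ => exact (eval_imp_eq_univ M).2 (eval_neg_or_neg M V φ ψ).le
  | m2 φ ψ =>
    refine (eval_imp_eq_univ M).2 (setOf_const_subset fun h => ?_)
    refine (eval_imp_eq_univ M).2 (setOf_const_subset fun h' => ?_)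
    rw [eval_imp_eq_univ, h'] at h
    exact (eval_box_eq_univ M).2 (univ_subset_iff.1 h)
  | m3 φ => exact (eval_imp_eq_univ M).2 (setOf_const_subset id)
  | m4 φ => exact (eval_imp_eq_univ M).2 fun x hx => by simpa [eval] using hx
  | m4_conv φ => exact (eval_imp_eq_univ M).2 fun x hx => by simpa [eval] using hx
  | b1 φ ψ =>
    -- A disjunction of boxed formulas is not classical, hence is read as a union.
    have hor : ¬ FreeOr (box (neg φ)) (box (cond ψ φ)) := by
      rintro ⟨_, c, hc⟩
      cases c <;> simp only [CForm.toForm, or.injEq, reduceCtorEq] at hc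
      rename_i c _
      cases c <;> simp [CForm.toForm] at hc
    rw [eval_imp_eq_univ, eval_or M V hor]
    refine setOf_const_subset fun h => ?_
    rw [eval_imp_eq_univ] at h
    rcases (eval M V φ).eq_empty_or_nonempty with he | hne
    · simp [eval, he]
    · simp [eval, M.cond_eq_univ (hm φ) (hm ψ) hne h]
  | b2 φ ψ η =>
    rw [eval_imp_eq_univ]
    simp only [eval]
    rw [M.cond_union (hm φ) (M.mem_compl (hm ψ)) (hm η), M.cond_compl (hm φ) (hm ψ)]
  | b3 φ ψ =>
    rw [eval_imp_eq_univ]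
    intro x hx
    have := Set.ext_iff.1 (M.cond_inter (hm φ) (hm ψ)) x
    simp only [eval, mem_inter_iff, mem_union, mem_compl_iff] at this hx ⊢
    tauto
  | b4 φ ψ =>
    rw [eval_imp_eq_univ]
    simp only [eval]
    rw [M.cond_compl (hm φ) (hm ψ), compl_compl]
  | b4_conv φ ψ =>
    rw [eval_imp_eq_univ]
    simp only [eval]
    rw [M.cond_compl (hm φ) (hm ψ), compl_compl]
  | b5 φ ψ =>
    refine (eval_imp_eq_univ M).2 (setOf_const_subset fun h => ?_)
    rw [eval_box_eq_univ, eval_iff_eq_univ]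
    exact h
  | b5_conv φ ψ =>
    refine (eval_imp_eq_univ M).2 (setOf_const_subset fun h => ?_)
    rw [eval_iff_eq_univ] at h
    exact setOf_const_eq_univ.2 h

theorem eval_indep_eq_univ {φ ψ : Form Θ} :
    eval M V (indep ψ φ) = univ ↔ M.Ind (eval M V φ) (eval M V ψ) :=
  setOf_const_eq_univ.trans (M.cond_eq_self_iff (eval_mem M hV φ) (eval_mem M hV ψ))

theorem eval_indep_imp {φ ψ φ' ψ' : Form Θ}
    (h : M.Ind (eval M V φ) (eval M V ψ) → M.Ind (eval M V φ') (eval M V ψ')) :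
    eval M V (imp (indep ψ φ) (indep ψ' φ')) = univ := by
  refine (eval_imp_eq_univ M).2 (setOf_const_subset fun h' => ?_)
  rw [M.cond_eq_self_iff (eval_mem M hV φ) (eval_mem M hV ψ)] at h'
  exact (eval_indep_eq_univ M hV).2 (h h')

theorem eval_fullAxiom {φ : Form Θ} (h : FullAxiom φ) : eval M V φ = univ := by
  cases h with
  | common h => exact eval_commonAxiom M hV h
  | b6 φ ψ => exact eval_indep_imp M hV M.ind_symm

theorem eval_starAxiom {φ : Form Θ} (h : StarAxiom φ) : eval M V φ = univ := by
  cases h with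
  | common h => exact eval_commonAxiom M hV h
  | b6_weak_A φ ψ => exact eval_indep_imp M hV M.ind_compl_left_iff.1
  | b6_weak_A_conv φ ψ => exact eval_indep_imp M hV M.ind_compl_left_iff.2
  | b6_weak_B φ ψ η =>
    refine (eval_imp_eq_univ M).2 (setOf_const_subset fun h => ?_)
    rw [eval_iff_eq_univ] at h
    rw [eval_box_eq_univ, eval_iff_eq_univ]
    simp only [eval, h]

omit hV in
theorem eval_provable {Ax : Form Θ → Prop} (hAx : ∀ φ, Ax φ → eval M V φ = univ)
    {φ : Form Θ} (h : Provable Ax φ) : eval M V φ = univ := by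
  induction h with
  | ax h => exact hAx _ h
  | mp _ _ h1 h2 => rw [eval_imp_eq_univ, h1] at h2; exact univ_subset_iff.1 h2
  | m1 _ h => exact (eval_box_eq_univ M).2 h

omit [Nonempty X] in
theorem P_eval_mem_Icc (φ : Form Θ) : M.P (eval M V φ) ∈ Icc (0 : ℝ) 1 :=
  M.P_mem_Icc (eval_mem M hV φ)

end Form

/-! ### Stages as partitions of `ℕ`, and their limit -/

/-- Each infinite block is in bijection with `ℕ` times the fiber of `r` over its index, so it can be
cut into infinite blocks indexed by that fiber. A refined space thus lives on the same `ℕ`. -/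
theorem exists_lift_infinite_fibers {ι κ : Type*} [Countable κ] {p : ℕ → ι}
    (hp : ∀ i, (p ⁻¹' {i}).Infinite) {r : κ → ι} (hr : Function.Surjective r) :
    ∃ p' : ℕ → κ, (∀ n, r (p' n) = p n) ∧ ∀ k, (p' ⁻¹' {k}).Infinite := by
  have he : ∀ i, Nonempty (↥(p ⁻¹' {i}) ≃ ℕ × {k // r k = i}) := by
    intro i
    have : Infinite ↥(p ⁻¹' {i}) := (hp i).to_subtype
    have : Nonempty {k // r k = i} := let ⟨k, hk⟩ := hr i; ⟨⟨k, hk⟩⟩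
    obtain ⟨_⟩ := nonempty_denumerable ↥(p ⁻¹' {i})
    obtain ⟨_⟩ := nonempty_denumerable (ℕ × {k // r k = i})
    exact ⟨Denumerable.equiv₂ _ _⟩
  let E := fun i => (he i).some
  have hE : ∀ i (x : ↥(p ⁻¹' {i})), ((E (p x)) ⟨x, rfl⟩).2.1 = (E i x).2.1 := by
    rintro _ ⟨x, rfl⟩
    rfl
  refine ⟨fun n => ((E (p n)) ⟨n, rfl⟩).2.1, fun n => ((E (p n)) ⟨n, rfl⟩).2.2, fun k => ?_⟩
  refine infinite_of_injective_forall_mem (f := fun m : ℕ => ((E (r k)).symm (m, ⟨k, rfl⟩)).1)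
    (fun m m' h => ?_) fun m => ?_
  · simpa using (E (r k)).symm.injective (Subtype.ext h)
  · change ((E (p _)) ⟨_, rfl⟩).2.1 = k
    rw [hE (r k) ((E (r k)).symm (m, ⟨k, rfl⟩))]
    simp

/-- A finite space of independence, realized as a partition of `ℕ` in infinite sets. -/
structure Stage where
  ι : Type v
  [fintype : Fintype ι]
  space : IndepSpace ι
  p : ℕ → ι
  infinite_fiber : ∀ i, (p ⁻¹' {i}).Infinite

namespace Stage

attribute [instance] Stage.fintype

variable (S : Stage.{v})

theorem surjective : Function.Surjective S.p := fun i => (S.infinite_fiber i).nonempty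

/-- Unions of blocks of the partition. -/
def Mem (A : Set ℕ) : Prop := ∃ s, A = S.p ⁻¹' s

/-- The probability of a union of blocks. -/
noncomputable def P (A : Set ℕ) : ℝ := mass S.space.w (S.p '' A)

/-- Independence of unions of blocks. -/
def Ind (A B : Set ℕ) : Prop := S.Mem A ∧ S.Mem B ∧ S.space.Ind (S.p '' A) (S.p '' B)

theorem mem_preimage (s : Set S.ι) : S.Mem (S.p ⁻¹' s) := ⟨s, rfl⟩

theorem P_preimage (s : Set S.ι) : S.P (S.p ⁻¹' s) = mass S.space.w s := by
  rw [P, image_preimage_eq s S.surjective]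

theorem ind_preimage_iff {s t : Set S.ι} :
    S.Ind (S.p ⁻¹' s) (S.p ⁻¹' t) ↔ S.space.Ind s t := by
  rw [Ind, image_preimage_eq s S.surjective, image_preimage_eq t S.surjective]
  exact ⟨fun h => h.2.2, fun h => ⟨S.mem_preimage s, S.mem_preimage t, h⟩⟩

theorem mem_univ : S.Mem univ := ⟨univ, rfl⟩

variable {S} {A B C : Set ℕ}

theorem Mem.compl (h : S.Mem A) : S.Mem Aᶜ := by
  obtain ⟨s, rfl⟩ := h; exact ⟨sᶜ, rfl⟩

theorem Mem.inter (h : S.Mem A) (h' : S.Mem B) : S.Mem (A ∩ B) := by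
  obtain ⟨s, rfl⟩ := h
  obtain ⟨t, rfl⟩ := h'
  exact ⟨s ∩ t, rfl⟩

theorem finite_mem : {A | S.Mem A}.Finite :=
  (finite_range fun s : Set S.ι => S.p ⁻¹' s).subset fun _ ⟨s, hs⟩ => ⟨s, hs.symm⟩

/-- The second stage has all the sets of the first, with the same probabilities and the same
independences between them. -/
structure Ext (S S' : Stage.{v}) : Prop where
  mem : ∀ {A}, S.Mem A → S'.Mem A
  P_eq : ∀ {A}, S.Mem A → S'.P A = S.P A
  ind_iff : ∀ {A B}, S.Mem A → S.Mem B → (S'.Ind A B ↔ S.Ind A B)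

theorem Ext.refl (S : Stage.{v}) : Ext S S := ⟨id, fun _ => rfl, fun _ _ => Iff.rfl⟩

theorem Ext.trans {S S' S'' : Stage.{v}} (h : Ext S S') (h' : Ext S' S'') : Ext S S'' :=
  ⟨fun hA => h'.mem (h.mem hA), fun hA => (h'.P_eq (h.mem hA)).trans (h.P_eq hA),
    fun hA hB => (h'.ind_iff (h.mem hA) (h.mem hB)).trans (h.ind_iff hA hB)⟩

theorem Ext.ind {S S' : Stage.{v}} (h : Ext S S') (hi : S.Ind A B) : S'.Ind A B :=
  (h.ind_iff hi.1 hi.2.1).2 hi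

theorem exists_ext_cond (hA : S.Mem A) :
    ∃ S', Ext S S' ∧ ∀ B, S.Mem B → A.Nonempty → ∃ C, S'.Ind A C ∧ C ∩ A = B ∩ A := by
  obtain ⟨a, rfl⟩ := hA
  by_cases ha : IndepSpace.Proper a
  · obtain ⟨p', hp, hinf⟩ := exists_lift_infinite_fibers S.infinite_fiber
      (IndepSpace.Pair.fst_surjective (S := S.space) ha)
    have hpre : ∀ s, S.p ⁻¹' s = p' ⁻¹' (IndepSpace.Pair.fst ⁻¹' s) := fun s => by
      ext n; simp [hp]
    let S' : Stage := ⟨S.space.Pair a, S.space.pairSpace ha, p', hinf⟩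
    refine ⟨S', ⟨?_, ?_, ?_⟩, ?_⟩
    · rintro _ ⟨s, rfl⟩
      exact ⟨_, hpre s⟩
    · rintro _ ⟨s, rfl⟩
      rw [P_preimage, hpre]
      exact (S'.P_preimage _).trans (IndepSpace.mass_preimage_fst ha s)
    · rintro _ _ ⟨s, rfl⟩ ⟨t, rfl⟩
      rw [ind_preimage_iff, hpre, hpre]
      exact S'.ind_preimage_iff.trans (IndepSpace.pairSpace_ind_preimage_iff ha)
    · rintro _ ⟨b, rfl⟩ _
      obtain ⟨c, hc, hc'⟩ := IndepSpace.exists_conditional (S := S.space) ha b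
      refine ⟨p' ⁻¹' c, ?_, ?_⟩
      · rw [hpre]
        exact S'.ind_preimage_iff.2 hc
      · rw [hpre, hpre, ← preimage_inter, ← preimage_inter, hc']
  -- A nonempty set that is not proper is everything, and then `B` is its own conditional.
  · refine ⟨S, .refl S, ?_⟩
    rintro _ ⟨b, rfl⟩ hne
    have : a = univ := by
      by_contra h
      exact ha ⟨nonempty_of_nonempty_preimage hne, nonempty_compl.2 h⟩
    subst this
    exact ⟨_, S.ind_preimage_iff.2 (S.space.ind_symm (S.space.ind_univ b)), rfl⟩

theorem exists_ext_forall_cond (S : Stage.{v}) :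
    ∃ S', Ext S S' ∧ ∀ A B, S.Mem A → S.Mem B → A.Nonempty →
      ∃ C, S'.Ind A C ∧ C ∩ A = B ∩ A := by
  -- The conditioning sets are treated one at a time. Conditionals found earlier remain valid, since
  -- extensions keep the same subsets of `ℕ` and their independences.
  suffices h : ∀ T : Set (Set ℕ), T.Finite → (∀ A ∈ T, S.Mem A) → ∃ S', Ext S S' ∧
      ∀ A ∈ T, ∀ B, S.Mem B → A.Nonempty → ∃ C, S'.Ind A C ∧ C ∩ A = B ∩ A by
    obtain ⟨S', h, h'⟩ := h _ finite_mem fun A hA => hA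
    exact ⟨S', h, fun A B hA hB hne => h' A hA B hB hne⟩
  intro T hT
  induction T, hT using Set.Finite.induction_on with
  | empty => exact fun _ => ⟨S, .refl S, fun A hA => hA.elim⟩
  | @insert A T _ _ ih =>
    intro hmem
    obtain ⟨S', h1, h2⟩ := ih fun B hB => hmem B (mem_insert_of_mem A hB)
    obtain ⟨S'', h3, h4⟩ := exists_ext_cond (h1.mem (hmem A (mem_insert A T)))
    refine ⟨S'', h1.trans h3, ?_⟩
    rintro A' (rfl | hA') B hB hne
    · exact h4 B (h1.mem hB) hne
    · obtain ⟨C, hC, hC'⟩ := h2 A' hA' B hB hne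
      exact ⟨C, h3.ind hC, hC'⟩

/-- Successive extensions, each of which conditions all the sets of the former one. -/
noncomputable def chain (S : Stage.{v}) : ℕ → Stage.{v}
  | 0 => S
  | n + 1 => (exists_ext_forall_cond (chain S n)).choose

theorem chain_ext_succ (S : Stage.{v}) (n : ℕ) : Ext (S.chain n) (S.chain (n + 1)) :=
  (exists_ext_forall_cond (chain S n)).choose_spec.1

theorem chain_ext (S : Stage.{v}) {m n : ℕ} (h : m ≤ n) : Ext (S.chain m) (S.chain n) := by
  induction n, h using Nat.le_induction with
  | base => exact .refl _
  | succ n _ ih => exact ih.trans (S.chain_ext_succ n)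

theorem exists_cond_chain (S : Stage.{v}) {n : ℕ} (hA : (S.chain n).Mem A)
    (hB : (S.chain n).Mem B) (hne : A.Nonempty) :
    ∃ C, (S.chain (n + 1)).Ind A C ∧ C ∩ A = B ∩ A :=
  (exists_ext_forall_cond (chain S n)).choose_spec.2 A B hA hB hne

theorem exists_chain_mem₂ (S : Stage.{v}) (hA : ∃ n, (S.chain n).Mem A)
    (hB : ∃ n, (S.chain n).Mem B) : ∃ n, (S.chain n).Mem A ∧ (S.chain n).Mem B := by
  obtain ⟨m, hA⟩ := hA
  obtain ⟨n, hB⟩ := hB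
  exact ⟨max m n, (S.chain_ext (le_max_left m n)).mem hA, (S.chain_ext (le_max_right m n)).mem hB⟩

open Classical in
/-- The common value of the probabilities of the stages of the chain. -/
noncomputable def limP (S : Stage.{v}) (A : Set ℕ) : ℝ :=
  if h : ∃ n, (S.chain n).Mem A then (S.chain h.choose).P A else 0

theorem limP_eq (S : Stage.{v}) {n : ℕ} (hA : (S.chain n).Mem A) : S.limP A = (S.chain n).P A := by
  have h : ∃ n, (S.chain n).Mem A := ⟨n, hA⟩
  rw [limP, dif_pos h]
  rcases le_total h.choose n with h' | h'
  · exact ((S.chain_ext h').P_eq h.choose_spec).symm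
  · exact (S.chain_ext h').P_eq hA

theorem Ind.symm (h : S.Ind A B) : S.Ind B A := ⟨h.2.1, h.1, S.space.ind_symm h.2.2⟩

theorem Mem.ind_univ (h : S.Mem A) : S.Ind A univ := by
  obtain ⟨s, rfl⟩ := h
  exact S.ind_preimage_iff.2 (S.space.ind_univ s)

theorem Ind.compl (h : S.Ind A B) : S.Ind A Bᶜ := by
  obtain ⟨⟨s, rfl⟩, ⟨t, rfl⟩, h'⟩ := id h
  rw [ind_preimage_iff] at h
  exact S.ind_preimage_iff.2 (S.space.ind_compl h)

theorem Ind.inter (h : S.Ind A B) (h' : S.Ind A C) : S.Ind A (B ∩ C) := by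
  obtain ⟨⟨s, rfl⟩, ⟨t, rfl⟩, _⟩ := id h
  obtain ⟨_, ⟨u, rfl⟩, _⟩ := id h'
  rw [ind_preimage_iff] at h h'
  exact S.ind_preimage_iff.2 (S.space.ind_inter h h')

theorem Ind.P_inter (h : S.Ind A B) : S.P (A ∩ B) = S.P A * S.P B := by
  obtain ⟨⟨s, rfl⟩, ⟨t, rfl⟩, _⟩ := id h
  rw [ind_preimage_iff] at h
  rw [← preimage_inter, P_preimage, P_preimage, P_preimage, S.space.ind_mass h]

theorem P_add (hA : S.Mem A) (hB : S.Mem B) : S.P (A ∩ B) + S.P (A ∪ B) = S.P A + S.P B := by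
  obtain ⟨s, rfl⟩ := hA
  obtain ⟨t, rfl⟩ := hB
  rw [← preimage_inter, ← preimage_union, P_preimage, P_preimage, P_preimage, P_preimage,
    mass_inter_add_union]

theorem P_pos (hA : S.Mem A) (hne : A.Nonempty) : 0 < S.P A := by
  obtain ⟨s, rfl⟩ := hA
  rw [P_preimage]
  exact mass_pos S.space.w_pos (nonempty_of_nonempty_preimage hne)

theorem P_univ (S : Stage.{v}) : S.P univ = 1 := by
  rw [← preimage_univ (f := S.p), P_preimage, mass_univ, S.space.w_sum]

theorem P_empty (S : Stage.{v}) : S.P ∅ = 0 := by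
  rw [← preimage_empty (f := S.p), P_preimage, mass_empty]

theorem mem_empty (S : Stage.{v}) : S.Mem ∅ := ⟨∅, rfl⟩

/-- The union of the chain of extensions. -/
noncomputable def limit (S : Stage.{v}) : CondField ℕ where
  Mem A := ∃ n, (S.chain n).Mem A
  mem_univ := ⟨0, (S.chain 0).mem_univ⟩
  mem_compl := fun ⟨n, h⟩ => ⟨n, h.compl⟩
  mem_inter := fun hA hB => let ⟨n, h, h'⟩ := S.exists_chain_mem₂ hA hB; ⟨n, h.inter h'⟩
  P := S.limP
  P_univ := (S.limP_eq (n := 0) (mem_univ _)).trans (P_univ _)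
  P_empty := (S.limP_eq (n := 0) (mem_empty _)).trans (P_empty _)
  P_add := by
    intro A B hA hB
    obtain ⟨n, h, h'⟩ := S.exists_chain_mem₂ hA hB
    have hu : (S.chain n).Mem (A ∪ B) := by
      rw [← compl_compl (A ∪ B), compl_union]
      exact (h.compl.inter h'.compl).compl
    rw [S.limP_eq h, S.limP_eq h', S.limP_eq (h.inter h'), S.limP_eq hu, P_add h h']
  P_pos := by
    rintro A ⟨n, h⟩ hne
    rw [S.limP_eq h]
    exact P_pos h hne
  Ind A B := ∃ n, (S.chain n).Ind A B
  ind_symm := fun ⟨n, h⟩ => ⟨n, h.symm⟩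
  ind_univ := fun ⟨n, h⟩ => ⟨n, h.ind_univ⟩
  ind_compl := fun ⟨n, h⟩ => ⟨n, h.compl⟩
  ind_inter := fun ⟨m, h⟩ ⟨n, h'⟩ => ⟨max m n,
    ((S.chain_ext (le_max_left m n)).ind h).inter ((S.chain_ext (le_max_right m n)).ind h')⟩
  ind_mul := by
    rintro A B ⟨n, h⟩
    rw [S.limP_eq h.1, S.limP_eq h.2.1, S.limP_eq (h.1.inter h.2.1), h.P_inter]
  ind_mem := fun ⟨n, h⟩ => ⟨n, h.2.1⟩
  exists_cond := by
    intro A B hA hB hne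
    obtain ⟨n, h, h'⟩ := S.exists_chain_mem₂ hA hB
    obtain ⟨C, hC, hC'⟩ := S.exists_cond_chain h h' hne
    exact ⟨C, ⟨n + 1, hC⟩, hC'⟩

end Stage

/-! ### Completeness of the classical logic -/

namespace CForm

variable {Θ : Type u}

/-- Truth of a classical formula under a valuation of the atoms and of the disjunctions whose
first member is not a negation, on which the axioms say nothing. -/
def Holds (v : CForm Θ → Prop) : CForm Θ → Prop
  | atom θ => v (atom θ)
  | bot => False
  | top => True
  | neg φ => ¬ Holds v φ
  | imp φ ψ => Holds v φ → Holds v ψ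
  | and φ ψ => Holds v φ ∧ Holds v ψ
  | or (neg φ) ψ => Holds v φ → Holds v ψ
  | or φ ψ => v (or φ ψ)

/-- Sets of formulas that contain the theorems and are closed under modus ponens. -/
structure IsTheory (T : Set (CForm Θ)) : Prop where
  provable : ∀ {φ}, Provable φ → φ ∈ T
  mp : ∀ {φ ψ}, φ ∈ T → imp φ ψ ∈ T → ψ ∈ T

namespace IsTheory

variable {T : Set (CForm Θ)} (hT : IsTheory T) {φ ψ χ : CForm Θ}
include hT

theorem imp_of_mem (h : φ ∈ T) : imp ψ φ ∈ T := hT.mp h (hT.provable (.c2 φ ψ))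

theorem imp_mp (h : imp χ φ ∈ T) (h' : imp χ (imp φ ψ) ∈ T) : imp χ ψ ∈ T :=
  hT.mp h (hT.mp h' (hT.provable (.c3 χ φ ψ)))

theorem imp_self (φ : CForm Θ) : imp φ φ ∈ T :=
  hT.imp_mp (hT.provable (.c2 φ φ)) (hT.provable (.c2 φ (imp φ φ)))

theorem imp_trans (h : imp φ ψ ∈ T) (h' : imp ψ χ ∈ T) : imp φ χ ∈ T :=
  hT.imp_mp h (hT.imp_of_mem h')

/-- The theory generated by a further formula. -/
theorem adjoin (φ : CForm Θ) : IsTheory {ψ | imp φ ψ ∈ T} where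
  provable h := hT.imp_of_mem (hT.provable h)
  mp h h' := hT.imp_mp h h'

theorem mem_of_neg_imp (h : imp (neg φ) (neg ψ) ∈ T) (h' : imp (neg φ) ψ ∈ T) : φ ∈ T :=
  hT.mp h' (hT.mp h (hT.provable (.c4 φ ψ)))

theorem neg_neg_imp (φ : CForm Θ) : imp (neg (neg φ)) φ ∈ T :=
  (hT.adjoin _).mem_of_neg_imp ((hT.adjoin _).imp_of_mem (hT.imp_self _))
    ((hT.adjoin _).imp_self _)

theorem contrapose (h : imp φ ψ ∈ T) : imp (neg ψ) (neg φ) ∈ T := by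
  have h1 := hT.adjoin (neg ψ)
  exact h1.mem_of_neg_imp (ψ := ψ) (h1.imp_of_mem (hT.imp_self _))
    (h1.imp_trans (h1.neg_neg_imp φ) (hT.imp_of_mem h))

theorem mem_of_cases (h : imp φ ψ ∈ T) (h' : imp (neg φ) ψ ∈ T) : ψ ∈ T :=
  hT.mem_of_neg_imp (hT.contrapose h') (hT.contrapose h)

theorem mem_of_mem_neg (h : φ ∈ T) (h' : neg φ ∈ T) (ψ : CForm Θ) : ψ ∈ T :=
  hT.mem_of_neg_imp (hT.imp_of_mem h') (hT.imp_of_mem h)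

end IsTheory

theorem exists_maximal_theory {φ : CForm Θ} (h : ¬ Provable φ) :
    ∃ T : Set (CForm Θ), Maximal (fun T => IsTheory T ∧ φ ∉ T) T := by
  have hchain : ∀ c ⊆ {T : Set (CForm Θ) | IsTheory T ∧ φ ∉ T}, IsChain (· ⊆ ·) c → c.Nonempty →
      ∃ ub ∈ {T : Set (CForm Θ) | IsTheory T ∧ φ ∉ T}, ∀ s ∈ c, s ⊆ ub := by
    refine fun c hc hchain ⟨s, hs⟩ => ⟨⋃₀ c, ⟨⟨fun hψ => ?_, ?_⟩, ?_⟩,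
      fun s hs => subset_sUnion_of_mem hs⟩
    · exact ⟨s, hs, (hc hs).1.provable hψ⟩
    · rintro ψ χ ⟨s, hs, h1⟩ ⟨t, ht, h2⟩
      rcases hchain.total hs ht with hst | hst
      · exact ⟨t, ht, (hc ht).1.mp (hst h1) h2⟩
      · exact ⟨s, hs, (hc hs).1.mp h1 (hst h2)⟩
    · rintro ⟨s, hs, h⟩
      exact (hc hs).2 h
  obtain ⟨T, _, hT⟩ := zorn_subset_nonempty _ hchain {ψ | Provable ψ} ⟨⟨id, .mp⟩, h⟩
  exact ⟨T, hT⟩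

/-- Membership in a theory maximal among those omitting `φ` is itself a valuation: it commutes with
the connectives, and the free disjunctions need no check because the valuation assigns them
directly. -/
theorem provable_of_holds {φ : CForm Θ} (h : ∀ v, Holds v φ) : Provable φ := by
  by_contra hφ
  obtain ⟨T, ⟨hT, hφT⟩, hmax⟩ := exists_maximal_theory hφ
  have hadj : ∀ {ψ}, ψ ∉ T → imp ψ φ ∈ T := by
    intro ψ hψ
    by_contra hn
    exact hψ (hmax (y := {χ | imp ψ χ ∈ T}) ⟨hT.adjoin ψ, hn⟩
      (fun χ hχ => hT.imp_of_mem hχ) (hT.imp_self ψ))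
  have hneg : ∀ ψ, neg ψ ∈ T ↔ ψ ∉ T := fun ψ =>
    ⟨fun h1 h2 => hφT (hT.mem_of_mem_neg h2 h1 φ),
      fun h1 => by_contra fun h2 => hφT (hT.mem_of_cases (hadj h1) (hadj h2))⟩
  have himp : ∀ ψ χ, imp ψ χ ∈ T ↔ (ψ ∈ T → χ ∈ T) := by
    refine fun ψ χ => ⟨fun h1 h2 => hT.mp h2 h1, fun h1 => ?_⟩
    by_cases hψ : ψ ∈ T
    · exact hT.imp_of_mem (h1 hψ)
    · exact (hT.adjoin ψ).mem_of_mem_neg (hT.imp_self ψ) (hT.imp_of_mem ((hneg ψ).2 hψ)) χ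
  have htop : (top : CForm Θ) ∈ T := hT.provable .c1
  have hor : ∀ ψ χ, or (neg ψ) χ ∈ T ↔ (ψ ∈ T → χ ∈ T) := fun ψ χ => by
    rw [← himp]
    exact ⟨fun h => hT.mp h (hT.provable (.c6_conv ψ χ)),
      fun h => hT.mp h (hT.provable (.c6 ψ χ))⟩
  have key : ∀ ψ, Holds (fun q => q ∈ T) ψ ↔ ψ ∈ T := by
    intro ψ
    induction ψ with
    | atom θ => exact Iff.rfl
    | bot =>
      refine iff_of_false id fun h => ?_
      exact (hneg top).1 (hT.mp h (hT.provable .c5)) htop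
    | top => exact iff_of_true trivial htop
    | neg ψ ih => rw [hneg, ← ih]; rfl
    | imp ψ χ h1 h2 => rw [himp, ← h1, ← h2]; rfl
    | and ψ χ h1 h2 =>
      have : and ψ χ ∈ T ↔ neg (or (neg ψ) (neg χ)) ∈ T :=
        ⟨fun h => hT.mp h (hT.provable (.c7 ψ χ)),
          fun h => hT.mp h (hT.provable (.c7_conv ψ χ))⟩
      rw [this, hneg, hor, hneg, ← h1, ← h2]
      simp only [Holds]; tauto
    | or ψ χ h1 h2 =>
      cases ψ with
      | neg ψ =>
        rw [hor, ← h2]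
        simp only [Holds] at h1 ⊢
        rw [hneg, not_iff_not] at h1
        rw [h1]
      | _ => simp only [Holds]
  exact hφT ((key φ).1 (h _))

/-! ### Finite distributions of valuations -/

/-- Formulas with the same models have the same probability. -/
theorem IsProbability.congr {π : CForm Θ → ℝ≥0} (hπ : IsProbability π) {φ ψ : CForm Θ}
    (h : ∀ v, Holds v φ ↔ Holds v ψ) : π φ = π ψ :=
  hπ.equivalence φ ψ (provable_of_holds fun v => ⟨(h v).1, (h v).2⟩)

theorem IsProbability.add_neg {π : CForm Θ → ℝ≥0} (hπ : IsProbability π) (φ ψ : CForm Θ) :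
    π (and φ (neg ψ)) + π (and φ ψ) = π φ := by
  -- The double negation makes the first member a negation, so that the disjunction has its usual
  -- meaning.
  have h := hπ.additivity (neg (neg (and φ (neg ψ)))) (and φ ψ)
  rw [hπ.congr (φ := and (neg (neg (and φ (neg ψ)))) (and φ ψ)) (ψ := bot)
      (fun v => by simp only [Holds]; tauto),
    hπ.congr (φ := or (neg (neg (and φ (neg ψ)))) (and φ ψ)) (ψ := φ)
      (fun v => by simp only [Holds]; tauto),
    hπ.congr (φ := neg (neg (and φ (neg ψ)))) (ψ := and φ (neg ψ))
      (fun v => by simp only [Holds]; tauto), hπ.coherence, zero_add] at h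
  exact h.symm

theorem exists_cell (F : Finset (CForm Θ)) (t : Set (CForm Θ)) :
    ∃ χ : CForm Θ, ∀ v, Holds v χ ↔ ∀ q ∈ F, Holds v q ↔ q ∈ t := by
  classical
  induction F using Finset.induction_on with
  | empty => exact ⟨top, fun v => by simp [Holds]⟩
  | insert q F _ ih =>
    obtain ⟨χ, hχ⟩ := ih
    by_cases hq : q ∈ t
    · exact ⟨and q χ, fun v => by simp [Holds, hχ, hq]⟩
    · exact ⟨and (neg q) χ, fun v => by simp [Holds, hχ, hq]⟩

/-- The conjunction of the formulas of `F` that are in `t` and of the negations of the others. -/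
noncomputable def cell (F : Finset (CForm Θ)) (t : Set (CForm Θ)) : CForm Θ :=
  (exists_cell F t).choose

theorem holds_cell {F : Finset (CForm Θ)} {t : Set (CForm Θ)} {v : CForm Θ → Prop} :
    Holds v (cell F t) ↔ ∀ q ∈ F, Holds v q ↔ q ∈ t :=
  (exists_cell F t).choose_spec v

theorem IsProbability.sum_cell {π : CForm Θ → ℝ≥0} (hπ : IsProbability π)
    (F : Finset (CForm Θ)) (φ : CForm Θ) :
    ∑ t ∈ F.powerset, π (and φ (cell F (t : Set (CForm Θ)))) = π φ := by
  classical
  induction F using Finset.induction_on with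
  | empty =>
    simp only [Finset.powerset_empty, Finset.sum_singleton]
    exact hπ.congr fun v => by simp [Holds, holds_cell]
  | insert q F hq ih =>
    rw [Finset.sum_powerset_insert hq, ← Finset.sum_add_distrib, ← ih]
    refine Finset.sum_congr rfl fun t ht => ?_
    have hqt : q ∉ t := fun h => hq (Finset.mem_powerset.1 ht h)
    rw [← hπ.add_neg (and φ (cell F (t : Set (CForm Θ)))) q]
    congr 1
    · refine hπ.congr fun v => ?_
      simp only [Holds, holds_cell, Finset.forall_mem_insert, Finset.mem_coe, hqt]
      tauto
    · refine hπ.congr fun v => ?_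
      have : (∀ p ∈ F, (Holds v p ↔ p = q ∨ p ∈ t)) ↔ ∀ p ∈ F, (Holds v p ↔ p ∈ t) :=
        forall₂_congr fun p hp => by
          rw [or_iff_right fun h : p = q => hq (h ▸ hp)]
      simp only [Holds, holds_cell, Finset.forall_mem_insert]
      simp only [Finset.mem_coe, Finset.mem_insert, true_or, this]
      tauto

/-- A probability over the classical logic is, on finitely many formulas, that of a finite
space of valuations of full support. -/
theorem IsProbability.exists_finite_space {π : CForm Θ → ℝ≥0} (hπ : IsProbability π)
    (F : Finset (CForm Θ)) :
    ∃ (ι : Type u) (_ : Fintype ι) (w : ι → ℝ) (val : ι → CForm Θ → Prop),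
      (∀ i, 0 < w i) ∧ ∑ i, w i = 1 ∧
      ∀ φ ∈ F, ∑ i, {i | Holds (val i) φ}.indicator w i = π φ := by
  classical
  -- Only the cells of nonzero probability are kept, which gives full support without any positivity
  -- of `π`. Such a cell has a model, otherwise it would be equivalent to `⊥`.
  let s : Finset (Finset (CForm Θ)) :=
    F.powerset.filter fun t => π (cell F (t : Set (CForm Θ))) ≠ 0
  have hval : ∀ i : s, ∃ v, Holds v (cell F (i.1 : Set (CForm Θ))) := by
    intro i
    by_contra! h
    refine (Finset.mem_filter.1 i.2).2 ?_
    rw [hπ.congr (ψ := bot) fun v => by simp [Holds, h v], hπ.coherence]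
  choose val hval using hval
  -- The discarded terms vanish, being bounded by the probability of a null cell.
  have hsum : ∀ f : Finset (CForm Θ) → ℝ≥0, (∀ t, f t ≤ π (cell F (t : Set (CForm Θ)))) →
      ∑ i : s, f i = ∑ t ∈ F.powerset, f t := by
    intro f hf
    rw [Finset.sum_coe_sort s f]
    refine Finset.sum_filter_of_ne fun t _ ht h => ht ?_
    exact le_antisymm (h ▸ hf t) zero_le
  refine ⟨s, inferInstance, fun i => π (cell F (i.1 : Set (CForm Θ))), val, fun i => ?_, ?_,
    fun φ hφ => ?_⟩
  · exact_mod_cast pos_iff_ne_zero.2 (Finset.mem_filter.1 i.2).2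
  · have h := hsum _ fun _ => le_rfl
    have h' := hπ.sum_cell F top
    rw [hπ.finiteness] at h'
    have e : ∀ t : Finset (CForm Θ), π (and top (cell F t)) = π (cell F (t : Set (CForm Θ))) :=
      fun t => hπ.congr fun v => by simp [Holds]
    simp only [e] at h'
    beta_reduce
    exact_mod_cast h.trans h'
  · have hle : ∀ t : Finset (CForm Θ), π (and φ (cell F t)) ≤ π (cell F (t : Set (CForm Θ))) := by
      intro t
      rw [← hπ.add_neg (cell F t) φ]
      refine le_of_eq_of_le (hπ.congr fun v => ?_) le_add_self
      simp only [Holds]; tauto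
    rw [← hπ.sum_cell F φ, ← hsum _ hle, NNReal.coe_sum]
    refine Finset.sum_congr rfl fun i _ => ?_
    have hi := holds_cell.1 (hval i) φ hφ
    by_cases h : Holds (val i) φ
    · rw [indicator_of_mem (s := {i | Holds (val i) φ}) h]
      refine congrArg _ (hπ.congr fun v => ?_)
      simp only [Holds, iff_and_self]
      exact fun hv => (holds_cell.1 hv φ hφ).2 (hi.1 h)
    · rw [indicator_of_notMem (s := {i | Holds (val i) φ}) h, hπ.congr (ψ := bot) fun v => ?_,
        hπ.coherence, NNReal.coe_zero]
      simp only [Holds, iff_false, not_and]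
      exact fun hv hc => h (hi.2 ((holds_cell.1 hc φ hφ).1 hv))

end CForm

/-! ### Classical formulas inside the full language -/

namespace CForm

variable {Θ : Type u}

theorem toForm_injective : Function.Injective (toForm : CForm Θ → Form Θ) := by
  intro φ
  induction φ with
  | atom θ => intro ψ h; cases ψ <;> simp_all [toForm]
  | bot => intro ψ h; cases ψ <;> simp_all [toForm]
  | top => intro ψ h; cases ψ <;> simp_all [toForm]
  | neg φ ih =>
    intro ψ h
    cases ψ <;> simp only [toForm, Form.neg.injEq, reduceCtorEq] at h
    rw [ih h]
  | imp φ χ h1 h2 =>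
    intro ψ h
    cases ψ <;> simp only [toForm, Form.imp.injEq, reduceCtorEq] at h
    rw [h1 h.1, h2 h.2]
  | and φ χ h1 h2 =>
    intro ψ h
    cases ψ <;> simp only [toForm, Form.and.injEq, reduceCtorEq] at h
    rw [h1 h.1, h2 h.2]
  | or φ χ h1 h2 =>
    intro ψ h
    cases ψ <;> simp only [toForm, Form.or.injEq, reduceCtorEq] at h
    rw [h1 h.1, h2 h.2]

theorem exists_of_toForm_eq_or {c : CForm Θ} {φ ψ : Form Θ} (h : c.toForm = .or φ ψ) :
    ∃ a b : CForm Θ, c = or a b ∧ a.toForm = φ ∧ b.toForm = ψ := by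
  cases c <;> simp only [toForm, Form.or.injEq, reduceCtorEq] at h
  exact ⟨_, _, rfl, h.1, h.2⟩

theorem eval_toForm {X : Type*} (M : CondField X) (V : CForm Θ → Set X) (φ : CForm Θ) :
    Form.eval M V φ.toForm = {x | Holds (fun q => x ∈ V q) φ} := by
  induction φ with
  | atom θ => rfl
  | bot => rfl
  | top => rfl
  | neg φ ih => simp only [toForm, Form.eval, ih]; rfl
  | imp φ ψ h1 h2 =>
    simp only [toForm, Form.eval, h1, h2]
    ext x
    exact imp_iff_not_or.symm
  | and φ ψ h1 h2 => simp only [toForm, Form.eval, h1, h2]; rfl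
  | or φ ψ h1 h2 =>
    by_cases hφ : ∃ χ, φ = neg χ
    · obtain ⟨χ, rfl⟩ := hφ
      rw [toForm, toForm, Form.eval_or_neg, h2]
      change (Form.eval M V χ.neg.toForm) ∪ _ = _
      rw [h1]
      ext x
      simp only [Holds]
      exact imp_iff_not_or.symm
    · have hfree : Form.FreeOr φ.toForm ψ.toForm := by
        refine ⟨fun χ h => hφ ?_, or φ ψ, rfl⟩
        cases φ <;> simp only [toForm, reduceCtorEq] at h
        exact ⟨_, rfl⟩
      have hc : hfree.2.choose = or φ ψ := toForm_injective hfree.2.choose_spec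
      rw [toForm, Form.eval, dif_pos hfree, hc]
      ext x
      cases φ with
      | neg χ => exact absurd ⟨χ, rfl⟩ hφ
      | _ => simp only [Holds]; rfl

end CForm

/-! ### Models that agree with `π` on finite sets, and the limit -/

/-- A finite probability space with the trivial relation of independence. -/
def trivialSpace {ι : Type*} [Fintype ι] (w : ι → ℝ) (hw : ∀ i, 0 < w i) (h : ∑ i, w i = 1) :
    IndepSpace ι where
  w := w
  w_pos := hw
  w_sum := h
  Ind s t := IndepSpace.Triv s ∨ IndepSpace.Triv t
  ind_symm := Or.symm
  ind_univ _ := .inr (.inr rfl)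
  ind_compl := fun h => h.imp_right IndepSpace.Triv.compl
  ind_inter := by
    rintro s t u (h | h) (h' | h')
    · exact .inl h
    · exact .inl h
    · exact .inl h'
    · rcases h.inter_cases u with e | e <;> rw [e]
      · exact .inr (.inl rfl)
      · exact .inr h'
  ind_mass := by
    rintro s t ((rfl | rfl) | (rfl | rfl)) <;> simp [mass_empty, mass_univ, h]

theorem CForm.IsProbability.exists_condField {Θ : Type u} {π : CForm Θ → ℝ≥0}
    (hπ : CForm.IsProbability π) (F : Finset (CForm Θ)) :
    ∃ (M : CondField ℕ) (V : CForm Θ → Set ℕ), (∀ q, M.Mem (V q)) ∧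
      ∀ φ ∈ F, M.P (Form.eval M V φ.toForm) = π φ := by
  obtain ⟨ι, _, w, val, hw, hsum, hval⟩ := hπ.exists_finite_space F
  have : Nonempty ι := by
    by_contra h
    rw [not_nonempty_iff] at h
    simp at hsum
  -- The partition of `ℕ` into a single block is refined into infinite blocks indexed by `ι`.
  obtain ⟨p, _, hp⟩ := exists_lift_infinite_fibers (p := fun _ : ℕ => ())
    (fun _ => by simpa using infinite_univ) (r := fun _ : ι => ())
    fun _ => ⟨Classical.arbitrary ι, rfl⟩
  let S : Stage := ⟨ι, trivialSpace w hw hsum, p, hp⟩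
  refine ⟨S.limit, fun q => p ⁻¹' {i | val i q}, fun q => ⟨0, S.mem_preimage _⟩, fun φ hφ => ?_⟩
  rw [CForm.eval_toForm]
  have hmem : (S.chain 0).Mem (p ⁻¹' {i | CForm.Holds (val i) φ}) := S.mem_preimage _
  exact (S.limP_eq hmem).trans ((S.P_preimage _).trans (hval φ hφ))

/-- A probability over the classical logic extends to any logic that is sound for the fields
of sets with conditionals. -/
theorem CForm.IsProbability.exists_extension {Θ : Type u} {π : CForm Θ → ℝ≥0}
    (hπ : CForm.IsProbability π) {Ax : Form Θ → Prop}
    (hAx : ∀ (M : CondField ℕ) (V : CForm Θ → Set ℕ), (∀ q, M.Mem (V q)) →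
      ∀ φ, Ax φ → Form.eval M V φ = univ) :
    ∃ P : Form Θ → ℝ≥0, Form.IsProbability Ax P ∧ ∀ φ : CForm Θ, P φ.toForm = π φ := by
  choose M V hV hP using hπ.exists_condField
  -- This ultrafilter contains `{F | φ ∈ F}` for each classical `φ`, so the limit equals `π φ`
  -- there; elsewhere the limit exists by compactness of the unit interval.
  let U : Ultrafilter (Finset (CForm Θ)) := .of atTop
  let f : Form Θ → Finset (CForm Θ) → ℝ := fun φ F => (M F).P (Form.eval (M F) (V F) φ)
  have hlim : ∀ φ, ∃ l ∈ Icc (0 : ℝ) 1, Tendsto (f φ) U (𝓝 l) := fun φ =>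
    isCompact_Icc.ultrafilter_le_nhds (U.map (f φ)) <| le_principal_iff.2 <| mem_map.2 <|
      Eventually.of_forall fun F => Form.P_eval_mem_Icc (M F) (hV F) φ
  choose l hl hf using hlim
  have hsound : ∀ F {φ}, Form.Provable Ax φ → Form.eval (M F) (V F) φ = univ :=
    fun F φ h => Form.eval_provable (M F) (hAx (M F) (V F) (hV F)) h
  have hext : ∀ φ : CForm Θ, l φ.toForm = π φ := fun φ => by
    refine tendsto_nhds_unique (hf _) (tendsto_const_nhds.congr' ?_)
    refine Ultrafilter.of_le atTop ((eventually_ge_atTop {φ}).mono fun F hF => ?_)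
    exact (hP F φ (hF (Finset.mem_singleton_self φ))).symm
  refine ⟨fun φ => ⟨l φ, (hl φ).1⟩, ⟨fun φ ψ h => NNReal.eq ?_, fun φ ψ => NNReal.eq ?_,
    NNReal.eq ?_, NNReal.eq ?_, fun φ ψ h => NNReal.eq ?_⟩, fun φ => NNReal.eq (hext φ)⟩
  · exact tendsto_nhds_unique (hf φ) ((hf ψ).congr fun F =>
      congrArg (M F).P ((Form.eval_iff_eq_univ (M F)).1 (hsound F h)).symm)
  · change l _ + l _ = l _ + l _
    -- A free disjunction is not evaluated as a union, so additivity may fail in the models; in the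
    -- limit it is that of `π`.
    by_cases hfree : Form.FreeOr φ ψ
    · obtain ⟨_, c, hc⟩ := hfree
      obtain ⟨a, b, rfl, rfl, rfl⟩ := CForm.exists_of_toForm_eq_or hc
      have := hπ.additivity a b
      have h1 : l (.and a.toForm b.toForm) = _ := hext (.and a b)
      have h2 : l (.or a.toForm b.toForm) = _ := hext (.or a b)
      rw [h1, h2, hext, hext]
      exact_mod_cast this
    · refine tendsto_nhds_unique ((hf _).add (hf _)) (((hf φ).add (hf ψ)).congr fun F => ?_)
      have := (M F).P_add (Form.eval_mem (M F) (hV F) φ) (Form.eval_mem (M F) (hV F) ψ)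
      rw [← Form.eval_or (M F) (V F) hfree] at this
      exact this.symm
  · exact tendsto_nhds_unique (hf _) (tendsto_const_nhds.congr fun F => (M F).P_empty.symm)
  · exact tendsto_nhds_unique (hf _) (tendsto_const_nhds.congr fun F => (M F).P_univ.symm)
  -- A provable independence holds in every model, so the product formula is exact for each `F` and
  -- passes to the limit.
  · refine tendsto_nhds_unique (hf _) (((hf φ).mul (hf ψ)).congr fun F => ?_)
    exact ((M F).ind_mul ((M F).ind_symm
      ((Form.eval_indep_eq_univ (M F) (hV F)).1 (hsound F h)))).symm

end DmBL

theorem mainTheorem4 {Θ : Type*} [Finite Θ] (π : DmBL.CForm Θ → ℝ≥0)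
    (hπ : DmBL.CForm.IsProbability π) :
    (∃ P : DmBL.Form Θ → ℝ≥0, DmBL.Form.IsProbability DmBL.Form.StarAxiom P ∧
      ∀ φ : DmBL.CForm Θ, P φ.toForm = π φ) ∧
    (∃ P : DmBL.Form Θ → ℝ≥0, DmBL.Form.IsProbability DmBL.Form.FullAxiom P ∧
      ∀ φ : DmBL.CForm Θ, P φ.toForm = π φ) :=
  ⟨hπ.exists_extension fun M _ hV _ => DmBL.Form.eval_starAxiom M hV,
    hπ.exists_extension fun M _ hV _ => DmBL.Form.eval_fullAxiom M hV⟩
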